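/- All links are oriented links in $S^3$, given by oriented link diagrams in the plane, two diagrams representing the same link if and only if they are related by planar isotopy and Reidemeister moves. A link diagram is *alternating* if over- and undercrossings alternate along its strands, and a link is *alternating* if it has an alternating diagram. For $n\ge 0$, a link diagram is *$n$-almost alternating* if $n$ crossing changes turn it into an alternating diagram. A link $L$ is *$n$-almost alternating*, and then has *dealternating number* $\mathrm{dalt}(L)=n$, if it has an $n$-almost alternating diagram and no diagram that can be turned into an alternating one by fewer crossing changes. *Almost alternating* means $1$-almost alternating. Tangle diagrams have four ends NW, NE, SW, SE (and carry no orientation). The sum $T+S$ places $S$ to the right of $T$ and joins the ends NE, SE of $T$ to the ends NW, SW of $S$, respectively. The integral tangle diagram $[n]$, $n\in\mathbb Z$, consists of $|n|$ horizontal half twists whose handedness is given by the sign of $n$; $[0]$ consists of two horizontal arcs. The product is $T*S=T'+S$, where $T'$ is the reflection of $T$ in the line through NW and SE in the plane of projection (which keeps over- and understrands). A *rational tangle diagram* is a diagram of the form $(\cdots(([a_1]*[a_2])*[a_3])*\cdots)*[a_k]$ with $k\ge 1$ and integers $a_1,\dots,a_k$. The numerator $N(T)$ is the closure of $T$ that joins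 NW to NE and SW to SE. A *Montesinos link* is a link that has a diagram of the form $N(R_1+\cdots+R_m)$ (with some orientation), where $m\ge 1$ and $R_1,\dots,R_m$ are rational tangle diagrams. **Proposition 6.5.** Every Montesinos link is alternating or almost alternating; that is, it has dealternating number at most $1$. -/

import Mathlib

/-! Link and tangle diagrams in the plane, in general position with respect to the height function.
Such a diagram is read from bottom to top; it is the list of its elementary slices, each of which
contains one local minimum (`cup`), one local maximum (`cap`) or one crossing (`cross`), all other
strands being vertical. Planar isotopy and the Reidemeister moves become local moves on lists. -/

namespace Knots

/-- An elementary slice. The number `i` counts the strands to the left of the nontrivial part.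
Cups carry a label in `α`: `α = Unit` for unoriented diagrams, and `α = Bool` for oriented ones,
where the label `true` says that the left leg of the cup is oriented upwards (and the right leg
downwards), `false` the opposite. In `cross i s` the strand that runs from the bottom left to the
top right passes over if `s = true`, and under if `s = false`. -/
inductive Slice (α : Type) : Type
  | cup (i : ℕ) (a : α)
  | cap (i : ℕ)
  | cross (i : ℕ) (s : Bool)

namespace Slice

variable {α : Type}

/-- The number of strands that enter the nontrivial part from below. -/
def inputs : Slice α → ℕ
  | cup _ _ => 0
  | cap _ => 2
  | cross _ _ => 2

/-- The number of strands that leave the nontrivial part at the top. -/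
def outputs : Slice α → ℕ
  | cup _ _ => 2
  | cap _ => 0
  | cross _ _ => 2

/-- The number of strands to the left of the nontrivial part. -/
def pos : Slice α → ℕ
  | cup i _ => i
  | cap i => i
  | cross i _ => i

/-- Put `k` further vertical strands to the left. -/
def shift (k : ℕ) : Slice α → Slice α
  | cup i a => cup (i + k) a
  | cap i => cap (i + k)
  | cross i s => cross (i + k) s

/-- Forget the label of a cup, that is, the orientation. -/
def forget : Slice α → Slice Unit
  | cup i _ => cup i ()
  | cap i => cap i
  | cross i s => cross i s

/-- The reflection of an unoriented slice in a horizontal line of the plane of projection. -/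
def flip : Slice Unit → Slice Unit
  | cup i _ => cap i
  | cap i => cup i ()
  | cross i s => cross i (!s)

/-- The effect of an oriented slice on the list of orientations (`true` = upwards) of the strands,
listed from left to right; `none` if the slice does not fit on top of these strands. -/
def act : Slice Bool → List Bool → Option (List Bool)
  | cup i a, l => if i ≤ l.length then some (l.take i ++ a :: (!a) :: l.drop i) else none
  | cap i, l =>
    match l.drop i with
    | a :: b :: r => if b = !a then some (l.take i ++ r) else none
    | _ => none
  | cross i _, l =>
    match l.drop i with
    | a :: b :: r => some (l.take i ++ b :: a :: r)
    | _ => none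

end Slice

open Slice

/-- Put a list of oriented slices, the first one at the bottom, on top of the given strands. -/
def run : List (Slice Bool) → List Bool → Option (List Bool)
  | [], l => some l
  | g :: w, l => (g.act l).bind (run w)

/-- An oriented link diagram: oriented slices that fit together, with no free ends. -/
structure LinkDiagram where
  word : List (Slice Bool)
  closed : run word [] = some []

/-! ### Equivalence of diagrams -/

/-- The local moves: planar isotopies (`exchange`, `zigzag`, `slide`) and the three Reidemeister
moves. Labels of cups that a move creates are determined by the strands that they are joined to,
because only moves between oriented diagrams are used. -/
inductive LocalMove {α : Type} : List (Slice α) → List (Slice α) → Prop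
  /-- The heights of two slices, one of which lies to the left of the other, are exchanged. -/
  | exchange (g h : Slice α) (hgh : g.pos ≤ h.pos) :
      LocalMove [g, h.shift g.outputs] [h.shift g.inputs, g]
  /-- A local minimum and a neighbouring local maximum cancel. -/
  | zigzag_left (i : ℕ) (a : α) : LocalMove [cup i a, cap (i + 1)] []
  | zigzag_right (i : ℕ) (a : α) : LocalMove [cup (i + 1) a, cap i] []
  /-- A crossing slides through a local minimum or maximum. -/
  | slide_cup (i : ℕ) (a : α) (s : Bool) :
      LocalMove [cup i a, cross (i + 1) s] [cup (i + 1) a, cross i (!s)]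
  | slide_cap (i : ℕ) (s : Bool) :
      LocalMove [cross (i + 1) s, cap i] [cross i (!s), cap (i + 1)]
  /-- First Reidemeister move, with the curl to the right or to the left of the strand. -/
  | reidemeister1_right (i : ℕ) (a : α) (s : Bool) :
      LocalMove [cup (i + 1) a, cross i s, cap (i + 1)] []
  | reidemeister1_left (i : ℕ) (a : α) (s : Bool) :
      LocalMove [cup i a, cross (i + 1) s, cap i] []
  /-- Second Reidemeister move. -/
  | reidemeister2 (i : ℕ) (s : Bool) : LocalMove [cross i s, cross i (!s)] []
  /-- Third Reidemeister move; the condition says that among the three strands there is a top one,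
  a middle one and a bottom one. -/
  | reidemeister3 (i : ℕ) (s t u : Bool) (h : s = t ∨ t = u) :
      LocalMove [cross i s, cross (i + 1) t, cross i u]
        [cross (i + 1) u, cross i t, cross (i + 1) s]

/-- `E` arises from `D` by one local move. -/
def LinkDiagram.Move (D E : LinkDiagram) : Prop :=
  ∃ u v l r, LocalMove l r ∧ D.word = u ++ l ++ v ∧ E.word = u ++ r ++ v

/-- An oriented link (up to isotopy): a class of oriented diagrams with respect to the equivalence
relation that is generated by planar isotopy and the Reidemeister moves. -/
def Link : Type := Quot LinkDiagram.Move

/-- `D` is a diagram of the link `L`. -/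
def Link.HasDiagram (L : Link) (D : LinkDiagram) : Prop := Quot.mk _ D = L

/-! ### Alternating diagrams and crossing changes -/

section Alternating

variable {α : Type}

/-- `(k, j)` is the point number `j` from the left (counted from `0`) at the level just below the
slice number `k`. Two such points are `Joined` if a single slice joins them by a piece of strand
that does not meet a crossing. -/
inductive Joined (w : List (Slice α)) : ℕ × ℕ → ℕ × ℕ → Prop
  | cup {k i : ℕ} {a : α} (h : w[k]? = some (cup i a)) : Joined w (k + 1, i) (k + 1, i + 1)
  | cup_left {k i j : ℕ} {a : α} (h : w[k]? = some (cup i a)) (hj : j < i) :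
      Joined w (k, j) (k + 1, j)
  | cup_right {k i j : ℕ} {a : α} (h : w[k]? = some (cup i a)) (hj : i ≤ j) :
      Joined w (k, j) (k + 1, j + 2)
  | cap {k i : ℕ} (h : w[k]? = some (cap i)) : Joined w (k, i) (k, i + 1)
  | cap_left {k i j : ℕ} (h : w[k]? = some (cap i)) (hj : j < i) : Joined w (k, j) (k + 1, j)
  | cap_right {k i j : ℕ} (h : w[k]? = some (cap i)) (hj : i ≤ j) :
      Joined w (k, j + 2) (k + 1, j)
  | cross_left {k i j : ℕ} {s : Bool} (h : w[k]? = some (cross i s)) (hj : j < i) :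
      Joined w (k, j) (k + 1, j)
  | cross_right {k i j : ℕ} {s : Bool} (h : w[k]? = some (cross i s)) (hj : i + 2 ≤ j) :
      Joined w (k, j) (k + 1, j)

/-- Two points lie on the same edge: one can go from one to the other along the diagram without
passing through a crossing. -/
def SameEdge (w : List (Slice α)) : ℕ × ℕ → ℕ × ℕ → Prop := Relation.EqvGen (Joined w)

/-- One of the four ends of a crossing: at its bottom or top, on its left or right. -/
@[ext]
structure CrossingEnd (w : List (Slice α)) where
  level : ℕ
  pos : ℕ
  sign : Bool
  top : Bool
  right : Bool
  isCrossing : w[level]? = some (cross pos sign)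

/-- The place of the end of a crossing. -/
def CrossingEnd.point {w : List (Slice α)} (e : CrossingEnd w) : ℕ × ℕ :=
  (e.level + e.top.toNat, e.pos + e.right.toNat)

/-- Whether the end belongs to the strand that passes over at this crossing. (The strand from the
bottom left to the top right has the ends with `top = right`.) -/
def CrossingEnd.isOver {w : List (Slice α)} (e : CrossingEnd w) : Bool :=
  (e.top == e.right) == e.sign

/-- Over- and undercrossings alternate along the strands: an edge that runs from one crossing end
to another one goes from an overcrossing to an undercrossing or vice versa. -/
def AlternatingWord (w : List (Slice α)) : Prop :=
  ∀ e e' : CrossingEnd w, e ≠ e' → SameEdge w e.point e'.point → e.isOver ≠ e'.isOver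

/-- `CrossingChanges n w w'`: changing precisely `n` of the crossings of `w` gives `w'`. -/
inductive CrossingChanges : ℕ → List (Slice α) → List (Slice α) → Prop
  | nil : CrossingChanges 0 [] []
  | keep {n : ℕ} {w w' : List (Slice α)} (g : Slice α) (h : CrossingChanges n w w') :
      CrossingChanges n (g :: w) (g :: w')
  | change {n : ℕ} {w w' : List (Slice α)} (i : ℕ) (s : Bool) (h : CrossingChanges n w w') :
      CrossingChanges (n + 1) (cross i s :: w) (cross i (!s) :: w')

end Alternating

/-- An alternating link diagram. -/
def LinkDiagram.IsAlternating (D : LinkDiagram) : Prop := AlternatingWord D.word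

/-- An `n`-almost alternating link diagram: `n` crossing changes make it alternating. -/
def LinkDiagram.IsNAlmostAlternating (n : ℕ) (D : LinkDiagram) : Prop :=
  ∃ E : LinkDiagram, CrossingChanges n D.word E.word ∧ E.IsAlternating

/-- An alternating link: it has an alternating diagram. -/
def Link.IsAlternating (L : Link) : Prop := ∃ D, L.HasDiagram D ∧ D.IsAlternating

/-- An `n`-almost alternating link: it has an `n`-almost alternating diagram, and no diagram that
fewer crossing changes make alternating. -/
def Link.IsNAlmostAlternating (n : ℕ) (L : Link) : Prop :=
  (∃ D, L.HasDiagram D ∧ D.IsNAlmostAlternating n) ∧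
    ∀ k < n, ¬ ∃ D, L.HasDiagram D ∧ D.IsNAlmostAlternating k

/-- An almost alternating link is a `1`-almost alternating link. -/
def Link.IsAlmostAlternating (L : Link) : Prop := L.IsNAlmostAlternating 1

/-- `L` has dealternating number `n`. -/
def Link.HasDealternatingNumber (L : Link) (n : ℕ) : Prop := L.IsNAlmostAlternating n

/-! ### Tangles and Montesinos links -/

/-- Unoriented tangle diagrams. Those used below have two ends SW, SE at the bottom and two ends
NW, NE at the top. -/
abbrev Tangle : Type := List (Slice Unit)

namespace Tangle

/-- The sum: `S` stands to the right of `T`, the end NE of `T` is joined to the end NW of `S`, and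
the end SE of `T` to the end SW of `S`. -/
def sum (T S : Tangle) : Tangle := cup 1 () :: (T ++ S.map (shift 2) ++ [cap 1])

/-- The rotation of the plane of projection by a quarter turn clockwise: SW becomes NW, NW becomes
NE, NE becomes SE and SE becomes SW. Up to planar isotopy, the end SW of the tangle is bent up on
its left side, and the end NE is bent down on its right side. -/
def rotate (T : Tangle) : Tangle := cup 0 () :: (T.map (shift 1) ++ [cap 2])

/-- The reflection of the plane of projection in the line through NW and SE, composed of the
reflection in a horizontal line and of the clockwise quarter turn. Heights over this plane, hence
over- and understrands, are kept. -/
def reflect (T : Tangle) : Tangle := rotate (T.map flip).reverse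

/-- The (Conway) product: the first factor is reflected in the line through NW and SE, and the
second factor is added. -/
def product (T S : Tangle) : Tangle := sum (reflect T) S

/-- A row of `n` crossings of the same kind: `n` horizontal half twists. The row of length `0`
consists of two horizontal arcs, from NW to NE and from SW to SE. -/
def twists (s : Bool) : ℕ → Tangle
  | 0 => [cap 0, cup 0 ()]
  | n + 1 => sum (twists s n) [cross 0 s]

/-- The integral tangle diagram `[n]`. -/
def integral : ℤ → Tangle
  | Int.ofNat n => twists true n
  | Int.negSucc n => twists false (n + 1)

/-- The rational tangle diagrams are `(⋯(([a₁] * [a₂]) * [a₃]) * ⋯) * [aₙ]` with `n ≥ 1` and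
arbitrary integers `aᵢ`. -/
inductive IsRational : Tangle → Prop
  | integral (a : ℤ) : IsRational (integral a)
  | product (T : Tangle) (a : ℤ) (hT : IsRational T) : IsRational (product T (integral a))

/-- The numerator closure: NW is joined to NE, and SW is joined to SE. -/
def numerator (T : Tangle) : Tangle := cup 0 () :: (T ++ [cap 0])

end Tangle

/-- A Montesinos link: a link one of whose diagrams is, apart from the orientation, of the form
`N(R₁ + ⋯ + Rₘ)` with `m ≥ 1` and rational tangle diagrams `R₁, …, Rₘ`. -/
def Link.IsMontesinos (L : Link) : Prop :=
  ∃ (D : LinkDiagram) (R : Tangle) (Rs : List Tangle), L.HasDiagram D ∧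
    (∀ T ∈ R :: Rs, Tangle.IsRational T) ∧
    D.word.map forget = Tangle.numerator (Rs.foldl Tangle.sum R)

end Knots

namespace Knots

open Slice

/-! ### Widths of unoriented words -/

/-! Colour the regions of a diagram like a checkerboard. Every crossing then has one of two types,
and a diagram all of whose crossings have the same type is alternating (`Checkered.alternating`). In
a word of slices, the type of a crossing is its sign combined with the parity of its position, so
putting one more strand to the left reverses it.

A rational tangle has slope in ℚ ∪ {∞}. One of nonnegative slope has a diagram with all crossings of
one type, and adding enough horizontal twists makes any slope nonnegative. Hence every rational
tangle is isotopic to `A + [-k]` with `A` rational and of one type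
(`Rationalish.exists_normalForm`). A row of twists can be flyped through a rational tangle
(`Rationalish.iso_flype`), so all the rows of a sum can be collected at its right end. Every
Montesinos link is therefore of the form `N(A + B)`, where `A` has one type and the row `B` has the
other (`exists_normalForm_sum`).

Now let the strand at the end SW of `A` run once around `A`, under the three other ends
(`iso_encircle`). This is an isotopy, but it puts one more strand to the left of `A`, so the types
of `A` and `B` agree. Of the three new crossings two also have this type, and changing the third
makes the diagram alternating. The dealternating number is thus at most `1`.

Slopes are handled by group actions. A tangle is a word with four upper ends, up to isotopy, and the
braid group on four strands acts by adding crossings. The flype says that on rational tangles twists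
on the left and on the right act alike, that is, the kernel of the map to the braid group on three
strands acts trivially. This holds for the tangles `0` and `∞`, and it spreads over their orbit
because the kernel is normal (`InOrbit.flypeFixed`). What remains is an action like that of the
modular group on slopes, in which every point of the orbit is reached by positive words only or by
negative words only (`InOrbit.hasSlope`).

Isotopies are built from unoriented words; `Iso.lifts` carries an orientation along them. The
explicit isotopies are checked by evaluating lists of moves (`iso_of_moves`). -/

/-- The word `w` fits on top of `n` strands, and `m` strands leave it at the top. -/
def Fits : List (Slice Unit) → ℕ → ℕ → Prop
  | [], n, m => n = m
  | g :: w, n, m => g.pos + g.inputs ≤ n ∧ Fits w (n - g.inputs + g.outputs) m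

theorem fits_append {u v : List (Slice Unit)} {n m : ℕ} :
    Fits (u ++ v) n m ↔ ∃ k, Fits u n k ∧ Fits v k m := by
  induction u generalizing n with
  | nil => simp [Fits]
  | cons g u ih => simp [Fits, ih, and_assoc]

@[simp] theorem pos_shift {α : Type} (g : Slice α) (k : ℕ) : (g.shift k).pos = g.pos + k := by
  cases g <;> rfl

@[simp] theorem inputs_shift {α : Type} (g : Slice α) (k : ℕ) : (g.shift k).inputs = g.inputs := by
  cases g <;> rfl

@[simp] theorem outputs_shift {α : Type} (g : Slice α) (k : ℕ) :
    (g.shift k).outputs = g.outputs := by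
  cases g <;> rfl

@[simp] theorem shift_zero {α : Type} (g : Slice α) : g.shift 0 = g := by cases g <;> rfl

theorem shift_shift {α : Type} (g : Slice α) (j k : ℕ) : (g.shift j).shift k = g.shift (j + k) := by
  cases g <;> simp [shift, Nat.add_assoc]

@[simp] theorem map_shift_zero {α : Type} (w : List (Slice α)) : w.map (shift 0) = w := by
  induction w <;> simp_all

@[simp] theorem map_shift_shift {α : Type} (w : List (Slice α)) (j k : ℕ) :
    (w.map (shift j)).map (shift k) = w.map (shift (j + k)) := by
  simp [List.map_map, Function.comp_def, shift_shift]

@[simp] theorem pos_flip (g : Slice Unit) : g.flip.pos = g.pos := by cases g <;> rfl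
@[simp] theorem inputs_flip (g : Slice Unit) : g.flip.inputs = g.outputs := by cases g <;> rfl
@[simp] theorem outputs_flip (g : Slice Unit) : g.flip.outputs = g.inputs := by cases g <;> rfl

theorem flip_shift (g : Slice Unit) (k : ℕ) : (g.shift k).flip = g.flip.shift k := by
  cases g <;> rfl

theorem Fits.shift {w : List (Slice Unit)} {n m : ℕ} (h : Fits w n m) (k : ℕ) :
    Fits (w.map (shift k)) (n + k) (m + k) := by
  induction w generalizing n with
  | nil => simpa [Fits] using h
  | cons g w ih =>
    obtain ⟨h1, h2⟩ := h
    refine ⟨by simp; omega, ?_⟩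
    have := ih h2
    simp only [inputs_shift, outputs_shift]
    convert this using 1
    omega

theorem Fits.widen {w : List (Slice Unit)} {n m : ℕ} (h : Fits w n m) (k : ℕ) :
    Fits w (n + k) (m + k) := by
  induction w generalizing n with
  | nil => simpa [Fits] using h
  | cons g w ih =>
    obtain ⟨h1, h2⟩ := h
    refine ⟨by omega, ?_⟩
    have := ih h2
    convert this using 1
    omega

theorem Fits.flip {w : List (Slice Unit)} {n m : ℕ} (h : Fits w n m) :
    Fits (w.map flip).reverse m n := by
  induction w generalizing n with
  | nil => simpa [Fits, eq_comm] using h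
  | cons g w ih =>
    obtain ⟨h1, h2⟩ := h
    simp only [List.map_cons, List.reverse_cons, fits_append]
    refine ⟨_, ih h2, ?_⟩
    simp only [Fits, pos_flip, inputs_flip, outputs_flip]
    omega

theorem Fits.unique {w : List (Slice Unit)} {n m m' : ℕ} (h : Fits w n m) (h' : Fits w n m') :
    m = m' := by
  induction w generalizing n with
  | nil => simp_all [Fits]
  | cons g w ih => exact ih h.2 h'.2

/-! ### Isotopy of unoriented words -/

/-- Two words that take `n` strands to `m` strands are related by local moves. -/
inductive Iso : ℕ → ℕ → List (Slice Unit) → List (Slice Unit) → Prop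
  | move {n m : ℕ} {l r : List (Slice Unit)} (h : LocalMove l r) (hl : Fits l n m)
      (hr : Fits r n m) : Iso n m l r
  | refl {n m : ℕ} {w : List (Slice Unit)} (h : Fits w n m) : Iso n m w w
  | symm {n m : ℕ} {w w' : List (Slice Unit)} (h : Iso n m w w') : Iso n m w' w
  | trans {n m : ℕ} {w w' w'' : List (Slice Unit)} (h : Iso n m w w') (h' : Iso n m w' w'') :
      Iso n m w w''
  | append {n k m : ℕ} {u u' v v' : List (Slice Unit)} (h : Iso n k u u') (h' : Iso k m v v') :
      Iso n m (u ++ v) (u' ++ v')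

theorem Iso.fits {n m : ℕ} {w w' : List (Slice Unit)} (h : Iso n m w w') :
    Fits w n m ∧ Fits w' n m := by
  induction h with
  | move h hl hr => exact ⟨hl, hr⟩
  | refl h => exact ⟨h, h⟩
  | symm h ih => exact ih.symm
  | trans h h' ih ih' => exact ⟨ih.1, ih'.2⟩
  | append h h' ih ih' =>
    exact ⟨fits_append.2 ⟨_, ih.1, ih'.1⟩, fits_append.2 ⟨_, ih.2, ih'.2⟩⟩

theorem LocalMove.map_shift {l r : List (Slice Unit)} (h : LocalMove l r) (k : ℕ) :
    LocalMove (l.map (shift k)) (r.map (shift k)) := by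
  cases h with
  | exchange g h hgh =>
    have := LocalMove.exchange (g.shift k) (h.shift k) (by simpa using hgh)
    simpa [shift_shift, Nat.add_comm] using this
  | zigzag_left i a =>
    simpa [shift, Nat.add_right_comm] using LocalMove.zigzag_left (i + k) a
  | zigzag_right i a =>
    simpa [shift, Nat.add_right_comm] using LocalMove.zigzag_right (i + k) a
  | slide_cup i a s =>
    simpa [shift, Nat.add_right_comm] using LocalMove.slide_cup (i + k) a s
  | slide_cap i s =>
    simpa [shift, Nat.add_right_comm] using LocalMove.slide_cap (i + k) s (α := Unit)
  | reidemeister1_right i a s =>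
    simpa [shift, Nat.add_right_comm] using LocalMove.reidemeister1_right (i + k) a s
  | reidemeister1_left i a s =>
    simpa [shift, Nat.add_right_comm] using LocalMove.reidemeister1_left (i + k) a s
  | reidemeister2 i s =>
    simpa [shift, Nat.add_right_comm] using LocalMove.reidemeister2 (i + k) s (α := Unit)
  | reidemeister3 i s t u h =>
    simpa [shift, Nat.add_right_comm] using LocalMove.reidemeister3 (i + k) s t u h (α := Unit)

/-- The list of moves is closed under reflection in a horizontal line: left and right zigzags, and
slides through minima and maxima, are interchanged, while the Reidemeister moves go to moves of
their own kind. Only `exchange` comes back with its two sides swapped, hence the disjunction. -/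
theorem LocalMove.flip {l r : List (Slice Unit)} (h : LocalMove l r) :
    LocalMove (l.map flip).reverse (r.map flip).reverse ∨
      LocalMove (r.map flip).reverse (l.map flip).reverse := by
  cases h with
  | exchange g h hgh =>
    right
    have := LocalMove.exchange g.flip h.flip (by simpa using hgh)
    simpa [flip_shift] using this
  | zigzag_left i a => exact .inl (.zigzag_right i a)
  | zigzag_right i a => exact .inl (.zigzag_left i a)
  | slide_cup i a s => exact .inl (.slide_cap i (!s))
  | slide_cap i s => exact .inl (.slide_cup i () (!s))
  | reidemeister1_right i a s => exact .inl (.reidemeister1_right i a (!s))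
  | reidemeister1_left i a s => exact .inl (.reidemeister1_left i a (!s))
  | reidemeister2 i s =>
    left
    simpa [Slice.flip] using LocalMove.reidemeister2 i s (α := Unit)
  | reidemeister3 i s t u h =>
    left
    exact .reidemeister3 i (!u) (!t) (!s) (by grind)

theorem Iso.shift {n m : ℕ} {w w' : List (Slice Unit)} (h : Iso n m w w') (k : ℕ) :
    Iso (n + k) (m + k) (w.map (shift k)) (w'.map (shift k)) := by
  induction h with
  | move h hl hr => exact .move (h.map_shift k) (hl.shift k) (hr.shift k)
  | refl h => exact .refl (h.shift k)
  | symm h ih => exact ih.symm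
  | trans h h' ih ih' => exact ih.trans ih'
  | append h h' ih ih' => simpa using ih.append ih'

theorem Iso.widen {n m : ℕ} {w w' : List (Slice Unit)} (h : Iso n m w w') (k : ℕ) :
    Iso (n + k) (m + k) w w' := by
  induction h with
  | move h hl hr => exact .move h (hl.widen k) (hr.widen k)
  | refl h => exact .refl (h.widen k)
  | symm h ih => exact ih.symm
  | trans h h' ih ih' => exact ih.trans ih'
  | append h h' ih ih' => exact ih.append ih'

theorem Iso.flip {n m : ℕ} {w w' : List (Slice Unit)} (h : Iso n m w w') :
    Iso m n (w.map flip).reverse (w'.map flip).reverse := by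
  induction h with
  | move h hl hr =>
    rcases h.flip with h | h
    · exact .move h hl.flip hr.flip
    · exact (Iso.move h hr.flip hl.flip).symm
  | refl h => exact .refl h.flip
  | symm h ih => exact ih.symm
  | trans h h' ih ih' => exact ih.trans ih'
  | append h h' ih ih' => simpa using ih'.append ih

/-! ### Isotopies of oriented diagrams over isotopies of unoriented words -/

/-- The effect of a slice on the orientations of the strands that enter its nontrivial part. -/
inductive LocalAct : Slice Bool → List Bool → List Bool → Prop
  | cup (i : ℕ) (a : Bool) : LocalAct (cup i a) [] [a, !a]
  | cap (i : ℕ) (a : Bool) : LocalAct (cap i) [a, !a] []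
  | cross (i : ℕ) (s a b : Bool) : LocalAct (cross i s) [a, b] [b, a]

theorem LocalAct.length_left {g : Slice Bool} {x y : List Bool} (h : LocalAct g x y) :
    x.length = g.inputs := by cases h <;> rfl

theorem LocalAct.length_right {g : Slice Bool} {x y : List Bool} (h : LocalAct g x y) :
    y.length = g.outputs := by cases h <;> rfl

theorem LocalAct.shift {g : Slice Bool} {x y : List Bool} {k : ℕ} :
    LocalAct (g.shift k) x y ↔ LocalAct g x y := by
  constructor
  · intro h
    cases g <;> cases h <;> constructor
  · intro h
    cases h <;> constructor

theorem LocalAct.act {g : Slice Bool} {l x y r : List Bool} (h : LocalAct g x y)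
    (hl : l.length = g.pos) : g.act (l ++ (x ++ r)) = some (l ++ (y ++ r)) := by
  cases h <;> simp only [pos] at hl <;> subst hl <;> simp [Slice.act]

/-- Converts the `take`/`drop` form of `act` into a factorization of the strands into left part,
active part and right part, in which disjoint slices can be compared. -/
theorem exists_localAct {g : Slice Bool} {l l' : List Bool} (h : g.act l = some l') :
    ∃ u x y v, l = u ++ (x ++ v) ∧ l' = u ++ (y ++ v) ∧ u.length = g.pos ∧ LocalAct g x y := by
  cases g with
  | cup i a =>
    simp only [Slice.act, Option.ite_none_right_eq_some, Option.some.injEq] at h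
    exact ⟨l.take i, [], [a, !a], l.drop i, by simp, by simp [← h.2], by simp [pos, h.1],
      .cup i a⟩
  | cap i =>
    simp only [Slice.act] at h
    split at h
    · rename_i a b r hd
      simp only [Option.ite_none_right_eq_some, Option.some.injEq] at h
      obtain ⟨rfl, rfl⟩ := h
      have hlen : i < l.length := by
        have := congrArg List.length hd
        simp at this; omega
      exact ⟨l.take i, [a, !a], [], r, by simp [← hd], by simp, by simp [pos]; omega,
        .cap i a⟩
    · simp at h
  | cross i s =>
    simp only [Slice.act] at h
    split at h
    · rename_i a b r hd
      simp only [Option.some.injEq] at h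
      subst h
      have hlen : i < l.length := by
        have := congrArg List.length hd
        simp at this; omega
      exact ⟨l.take i, [a, b], [b, a], r, by simp [← hd], by simp, by simp [pos]; omega,
        .cross i s a b⟩
    · simp at h

theorem run_append (u v : List (Slice Bool)) (l : List Bool) :
    run (u ++ v) l = (run u l).bind (run v) := by
  induction u generalizing l with
  | nil => rfl
  | cons g u ih =>
    simp only [List.cons_append, run]
    cases g.act l <;> simp [ih]

theorem run_append_eq_some {u v : List (Slice Bool)} {l l' : List Bool} :
    run (u ++ v) l = some l' ↔ ∃ k, run u l = some k ∧ run v k = some l' := by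
  simp [run_append, Option.bind_eq_some_iff]

theorem run_cons_eq_some {g : Slice Bool} {v : List (Slice Bool)} {l l' : List Bool} :
    run (g :: v) l = some l' ↔ ∃ k, g.act l = some k ∧ run v k = some l' := by
  simp [run, Option.bind_eq_some_iff]

theorem fits_of_run {w : List (Slice Bool)} {l l' : List Bool} (h : run w l = some l') :
    Fits (w.map forget) l.length l'.length := by
  induction w generalizing l with
  | nil => simp only [run, Option.some.injEq] at h; simp [Fits, h]
  | cons g w ih =>
    obtain ⟨k, h1, h2⟩ := run_cons_eq_some.1 h
    obtain ⟨u, x, y, v, rfl, rfl, hu, hg⟩ := exists_localAct h1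
    have h3 := ih h2
    have e1 : g.forget.pos = g.pos := by cases g <;> rfl
    have e2 : g.forget.inputs = g.inputs := by cases g <;> rfl
    have e3 : g.forget.outputs = g.outputs := by cases g <;> rfl
    simp only [List.map_cons, Fits, e1, e2, e3]
    simp only [List.length_append, hg.length_left, hg.length_right, hu] at h3 ⊢
    refine ⟨by omega, ?_⟩
    convert h3 using 1
    omega

/-- A local move between oriented words that take the strands `l` to `l'`. -/
def OrientedStep (l l' : List Bool) (w w' : List (Slice Bool)) : Prop :=
  run w l = some l' ∧ run w' l = some l' ∧
    ∃ u v a b, LocalMove a b ∧ w = u ++ a ++ v ∧ w' = u ++ b ++ v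

/-- The oriented words, which take the strands `l` to `l'`, are related by local moves. -/
def OrientedIso (l l' : List Bool) : List (Slice Bool) → List (Slice Bool) → Prop :=
  Relation.EqvGen (OrientedStep l l')

theorem OrientedIso.append_right {l k l' : List Bool} {u u' v : List (Slice Bool)}
    (h : OrientedIso l k u u') (hv : run v k = some l') : OrientedIso l l' (u ++ v) (u' ++ v) := by
  induction h with
  | rel x y h =>
    obtain ⟨h1, h2, p, q, a, b, hm, rfl, rfl⟩ := h
    refine .rel _ _ ⟨run_append_eq_some.2 ⟨_, h1, hv⟩, run_append_eq_some.2 ⟨_, h2, hv⟩,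
      p, q ++ v, a, b, hm, by simp, by simp⟩
  | refl x => exact .refl _
  | symm x y _ ih => exact .symm _ _ ih
  | trans x y z _ _ ih ih' => exact .trans _ _ _ ih ih'

theorem OrientedIso.append_left {l k l' : List Bool} {u v v' : List (Slice Bool)}
    (h : OrientedIso k l' v v') (hu : run u l = some k) : OrientedIso l l' (u ++ v) (u ++ v') := by
  induction h with
  | rel x y h =>
    obtain ⟨h1, h2, p, q, a, b, hm, rfl, rfl⟩ := h
    refine .rel _ _ ⟨run_append_eq_some.2 ⟨_, hu, h1⟩, run_append_eq_some.2 ⟨_, hu, h2⟩,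
      u ++ p, q, a, b, hm, by simp, by simp⟩
  | refl x => exact .refl _
  | symm x y _ ih => exact .symm _ _ ih
  | trans x y z _ _ ih ih' => exact .trans _ _ _ ih ih'

theorem OrientedIso.run_iff {l l' : List Bool} {w w' : List (Slice Bool)}
    (h : OrientedIso l l' w w') : run w l = some l' ↔ run w' l = some l' := by
  induction h with
  | rel x y h => simp [h.1, h.2.1]
  | refl x => rfl
  | symm x y _ ih => exact ih.symm
  | trans x y z _ _ ih ih' => exact ih.trans ih'

/-- Transitivity needs the intermediate word to be a closed diagram as well; `OrientedStep` demands
this of its two words, and `OrientedIso.run_iff` passes it along the chain. -/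
theorem OrientedIso.link_eq {w w' : List (Slice Bool)} (h : OrientedIso [] [] w w')
    (hw : run w [] = some []) (hw' : run w' [] = some []) :
    Quot.mk LinkDiagram.Move ⟨w, hw⟩ = Quot.mk LinkDiagram.Move ⟨w', hw'⟩ := by
  induction h with
  | rel x y h =>
    obtain ⟨-, -, u, v, a, b, hm, h1, h2⟩ := h
    exact Quot.sound ⟨u, v, a, b, hm, h1, h2⟩
  | refl x => rfl
  | symm x y _ ih => exact (ih hw' hw).symm
  | trans x y z h h' ih ih' =>
    have hy := (OrientedIso.run_iff h).1 hw
    exact (ih hw hy).trans (ih' hy hw')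

theorem exists_of_forget_eq_shift {x : Slice Bool} {h : Slice Unit} {k : ℕ}
    (hx : x.forget = h.shift k) : ∃ h' : Slice Bool, x = h'.shift k ∧ h'.forget = h := by
  cases x <;> cases h <;> simp only [forget, shift, Slice.cup.injEq, Slice.cap.injEq,
    Slice.cross.injEq, reduceCtorEq] at hx
  · rename_i i a j b
    exact ⟨.cup j a, by simp [shift, hx.1], rfl⟩
  · rename_i i j
    exact ⟨.cap j, by simp [shift, hx], rfl⟩
  · rename_i i s j t
    exact ⟨.cross j s, by simp [shift, hx], by simp [forget, hx.2]⟩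

@[simp] theorem forget_shift (g : Slice Bool) (k : ℕ) : (g.shift k).forget = g.forget.shift k := by
  cases g <;> rfl

@[simp] theorem pos_forget (g : Slice Bool) : g.forget.pos = g.pos := by cases g <;> rfl
@[simp] theorem inputs_forget (g : Slice Bool) : g.forget.inputs = g.inputs := by cases g <;> rfl
@[simp] theorem outputs_forget (g : Slice Bool) : g.forget.outputs = g.outputs := by
  cases g <;> rfl

theorem forget_eq_cup {g : Slice Bool} {i : ℕ} {u : Unit} :
    g.forget = cup i u ↔ ∃ a, g = cup i a := by
  cases g <;> simp [forget]

theorem forget_eq_cap {g : Slice Bool} {i : ℕ} : g.forget = cap i ↔ g = cap i := by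
  cases g <;> simp [forget]

theorem forget_eq_cross {g : Slice Bool} {i : ℕ} {s : Bool} :
    g.forget = cross i s ↔ g = cross i s := by
  cases g <;> simp [forget]

/-- The two slices act on disjoint blocks of strands, so the order of the actions does not matter.
-/
theorem run_exchange {g h : Slice Bool} (hgh : g.pos ≤ h.pos) {l l' : List Bool} :
    run [g, h.shift g.outputs] l = some l' ↔ run [h.shift g.inputs, g] l = some l' := by
  constructor
  · intro H
    obtain ⟨k, h1, H⟩ := run_cons_eq_some.1 H
    obtain ⟨k', h2, H⟩ := run_cons_eq_some.1 H
    simp only [run, Option.some.injEq] at H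
    subst H
    obtain ⟨u, x, y, v, rfl, rfl, hu, hg⟩ := exists_localAct h1
    obtain ⟨u', x', y', v', e, rfl, hu', hh⟩ := exists_localAct h2
    rw [LocalAct.shift] at hh
    have hy := hg.length_right
    have hx := hg.length_left
    simp only [pos_shift] at hu'
    rw [← List.append_assoc, List.append_eq_append_iff] at e
    obtain ⟨m, rfl, rfl⟩ | ⟨m, hm, e⟩ := e
    · simp only [List.length_append] at hu'
      refine run_cons_eq_some.2 ⟨u ++ (x ++ (m ++ (y' ++ v'))), ?_, run_cons_eq_some.2 ⟨_, hg.act hu, ?_⟩⟩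
      · have := (LocalAct.shift.2 hh : LocalAct (h.shift g.inputs) x' y').act
          (l := u ++ (x ++ m)) (r := v') (by simp; omega)
        simpa using this
      · simp [run]
    -- Here the left part of the second slice would end inside the block of the first one; its
    -- length forbids this unless `m` is empty.
    · have hm' := congrArg List.length hm
      simp only [List.length_append] at hm'
      obtain rfl : m = [] := List.length_eq_zero_iff.1 (by omega)
      simp only [List.append_nil, List.nil_append] at hm e
      subst hm e
      simp only [List.length_append] at hu'
      refine run_cons_eq_some.2 ⟨u ++ (x ++ (y' ++ v')), ?_, run_cons_eq_some.2 ⟨_, hg.act hu, ?_⟩⟩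
      · have := (LocalAct.shift.2 hh : LocalAct (h.shift g.inputs) x' y').act
          (l := u ++ x) (r := v') (by simp; omega)
        simpa using this
      · simp [run]
  · intro H
    obtain ⟨k, h1, H⟩ := run_cons_eq_some.1 H
    obtain ⟨k', h2, H⟩ := run_cons_eq_some.1 H
    simp only [run, Option.some.injEq] at H
    subst H
    obtain ⟨u, x, y, v, rfl, rfl, hu, hg⟩ := exists_localAct h1
    obtain ⟨u', x', y', v', e, rfl, hu', hh⟩ := exists_localAct h2
    rw [LocalAct.shift] at hg
    have hx := hh.length_left
    have hy := hh.length_right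
    simp only [pos_shift] at hu
    rw [← List.append_assoc u' x' v', List.append_eq_append_iff] at e
    obtain ⟨m, hm, e⟩ | ⟨m, rfl, rfl⟩ := e
    · have hm' := congrArg List.length hm
      simp only [List.length_append] at hm'
      obtain rfl : m = [] := List.length_eq_zero_iff.1 (by omega)
      simp only [List.append_nil, List.nil_append] at hm e
      subst hm e
      refine run_cons_eq_some.2 ⟨u' ++ (y' ++ (x ++ v)), ?_, run_cons_eq_some.2
        ⟨u' ++ (y' ++ (y ++ v)), ?_, ?_⟩⟩
      · simpa using hh.act (r := x ++ v) hu'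
      · have := (LocalAct.shift.2 hg : LocalAct (h.shift g.outputs) x y).act
          (l := u' ++ y') (r := v) (by simp at hu ⊢; omega)
        simpa using this
      · simp [run]
    · refine run_cons_eq_some.2 ⟨u' ++ (y' ++ (m ++ (x ++ v))), ?_, run_cons_eq_some.2
        ⟨u' ++ (y' ++ (m ++ (y ++ v))), ?_, ?_⟩⟩
      · simpa using hh.act (r := m ++ (x ++ v)) hu'
      · have := (LocalAct.shift.2 hg : LocalAct (h.shift g.outputs) x y).act
          (l := u' ++ (y' ++ m)) (r := v) (by simp at hu ⊢; omega)
        simpa using this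
      · simp [run]

theorem exists_cons_of_lt_length {l : List Bool} {i : ℕ} (h : i < l.length) :
    ∃ u c v, l = u ++ c :: v ∧ u.length = i :=
  ⟨l.take i, l[i], l.drop (i + 1), by simp, by simp; omega⟩

theorem exists_cons_cons_of_length {l : List Bool} (h : 2 ≤ l.length) :
    ∃ a b v, l = a :: b :: v := by
  match l, h with
  | a :: b :: v, _ => exact ⟨a, b, v, rfl⟩

theorem act_cup {i : ℕ} {a : Bool} {u v : List Bool} (hu : u.length = i) :
    (cup i a).act (u ++ v) = some (u ++ a :: (!a) :: v) := by
  subst hu; simp [Slice.act]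

theorem act_cap {i : ℕ} {a b : Bool} {u v : List Bool} (hu : u.length = i) :
    (cap i).act (u ++ a :: b :: v) = if b = !a then some (u ++ v) else none := by
  subst hu; simp [Slice.act]

theorem act_cross {i : ℕ} {s a b : Bool} {u v : List Bool} (hu : u.length = i) :
    (cross i s).act (u ++ a :: b :: v) = some (u ++ b :: a :: v) := by
  subst hu; simp [Slice.act]

theorem act_cap_succ {i : ℕ} {a b c : Bool} {u v : List Bool} (hu : u.length = i) :
    (cap (i + 1)).act (u ++ c :: a :: b :: v) =
      if b = !a then some (u ++ c :: v) else none := by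
  simpa using act_cap (u := u ++ [c]) (v := v) (a := a) (b := b) (i := i + 1) (by simp [hu])

theorem act_cup_succ {i : ℕ} {a c : Bool} {u v : List Bool} (hu : u.length = i) :
    (cup (i + 1) a).act (u ++ c :: v) = some (u ++ c :: a :: (!a) :: v) := by
  simpa using act_cup (u := u ++ [c]) (v := v) (a := a) (i := i + 1) (by simp [hu])

theorem act_cross_succ {i : ℕ} {s a b c : Bool} {u v : List Bool} (hu : u.length = i) :
    (cross (i + 1) s).act (u ++ c :: a :: b :: v) = some (u ++ c :: b :: a :: v) := by
  simpa using act_cross (u := u ++ [c]) (v := v) (a := a) (b := b) (s := s) (i := i + 1)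
    (by simp [hu])

/-! ### Lifting isotopies to oriented diagrams -/

/-- An isotopy lifts from unoriented to oriented words. -/
def Lifts (n : ℕ) (w w' : List (Slice Unit)) : Prop :=
  ∀ (W : List (Slice Bool)) (l l' : List Bool), W.map forget = w → l.length = n →
    run W l = some l' → ∃ W', W'.map forget = w' ∧ OrientedIso l l' W W'

/-- A cup that a move creates is joined to strands already present, and these dictate its label;
labels of cups that survive are kept. `Fits` guarantees that the required strands exist. -/
theorem lifts_move {l r : List (Slice Unit)} (h : LocalMove l r) {n m : ℕ} (hl : Fits l n m)
    (hr : Fits r n m) : Lifts n l r ∧ Lifts n r l := by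
  have key : (∀ (W : List (Slice Bool)) (p q : List Bool), W.map forget = l → p.length = n →
      run W p = some q → ∃ W', W'.map forget = r ∧ LocalMove W W' ∧ run W' p = some q) ∧
    (∀ (W : List (Slice Bool)) (p q : List Bool), W.map forget = r → p.length = n →
      run W p = some q → ∃ W', W'.map forget = l ∧ LocalMove W' W ∧ run W' p = some q) := by
    cases h with
    | exchange g h hgh =>
      constructor
      · intro W p q hW _ hrun
        obtain ⟨g', W, rfl, rfl, hW⟩ := List.map_eq_cons_iff.1 hW
        obtain ⟨x, W, rfl, hx, hW⟩ := List.map_eq_cons_iff.1 hW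
        obtain rfl := List.map_eq_nil_iff.1 hW
        obtain ⟨h', rfl, rfl⟩ := exists_of_forget_eq_shift hx
        simp only [pos_forget, outputs_forget, inputs_forget] at hgh hrun ⊢
        exact ⟨[h'.shift g'.inputs, g'], by simp, .exchange g' h' hgh, (run_exchange hgh).1 hrun⟩
      · intro W p q hW _ hrun
        obtain ⟨x, W₁, rfl, hx, hW₁⟩ := List.map_eq_cons_iff.1 hW
        obtain ⟨g', W₂, rfl, rfl, hW₂⟩ := List.map_eq_cons_iff.1 hW₁
        obtain rfl := List.map_eq_nil_iff.1 hW₂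
        obtain ⟨h', rfl, rfl⟩ := exists_of_forget_eq_shift hx
        simp only [pos_forget, outputs_forget, inputs_forget] at hgh hrun ⊢
        exact ⟨[g', h'.shift g'.outputs], by simp, .exchange g' h' hgh, (run_exchange hgh).2 hrun⟩
    | zigzag_left i a =>
      simp only [Fits, Slice.pos, Slice.inputs, Slice.outputs] at hl
      constructor
      · rintro W p q hW hp hrun
        obtain ⟨x, W₁, rfl, hx, hW₁⟩ := List.map_eq_cons_iff.1 hW
        obtain ⟨b, rfl⟩ := forget_eq_cup.1 hx
        obtain ⟨y, W₂, rfl, hy, hW₂⟩ := List.map_eq_cons_iff.1 hW₁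
        obtain rfl := forget_eq_cap.1 hy
        obtain rfl := List.map_eq_nil_iff.1 hW₂
        obtain ⟨u, c, v, rfl, hu⟩ := exists_cons_of_lt_length (l := p) (i := i) (by omega)
        simp [run, act_cup hu, act_cap_succ hu] at hrun
        exact ⟨[], rfl, .zigzag_left i b, by simp [run, ← hrun]⟩
      · rintro W p q hW hp hrun
        obtain rfl := List.map_eq_nil_iff.1 hW
        obtain ⟨u, c, v, rfl, hu⟩ := exists_cons_of_lt_length (l := p) (i := i) (by omega)
        simp [run] at hrun
        exact ⟨[cup i c, cap (i + 1)], rfl, .zigzag_left i c, by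
          simp [run, act_cup hu, act_cap_succ hu, ← hrun]⟩
    | zigzag_right i a =>
      simp only [Fits, Slice.pos, Slice.inputs, Slice.outputs] at hl
      constructor
      · rintro W p q hW hp hrun
        obtain ⟨x, W₁, rfl, hx, hW₁⟩ := List.map_eq_cons_iff.1 hW
        obtain ⟨b, rfl⟩ := forget_eq_cup.1 hx
        obtain ⟨y, W₂, rfl, hy, hW₂⟩ := List.map_eq_cons_iff.1 hW₁
        obtain rfl := forget_eq_cap.1 hy
        obtain rfl := List.map_eq_nil_iff.1 hW₂
        obtain ⟨u, c, v, rfl, hu⟩ := exists_cons_of_lt_length (l := p) (i := i) (by omega)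
        simp [run, act_cup_succ hu, act_cap hu] at hrun
        obtain ⟨rfl, hrun⟩ := hrun
        exact ⟨[], rfl, .zigzag_right i _, by simpa [run] using hrun⟩
      · rintro W p q hW hp hrun
        obtain rfl := List.map_eq_nil_iff.1 hW
        obtain ⟨u, c, v, rfl, hu⟩ := exists_cons_of_lt_length (l := p) (i := i) (by omega)
        simp [run] at hrun
        -- The cap joins the given strand `c` to the left leg of the cup, whose label must therefore
        -- be `!c`.
        exact ⟨[cup (i + 1) (!c), cap i], rfl, .zigzag_right i (!c), by
          simp [run, act_cup_succ hu, act_cap hu, ← hrun]⟩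
    | slide_cup i a s =>
      simp only [Fits, Slice.pos, Slice.inputs, Slice.outputs] at hl
      constructor
      · rintro W p q hW hp hrun
        obtain ⟨x, W₁, rfl, hx, hW₁⟩ := List.map_eq_cons_iff.1 hW
        obtain ⟨b, rfl⟩ := forget_eq_cup.1 hx
        obtain ⟨y, W₂, rfl, hy, hW₂⟩ := List.map_eq_cons_iff.1 hW₁
        obtain rfl := forget_eq_cross.1 hy
        obtain rfl := List.map_eq_nil_iff.1 hW₂
        obtain ⟨u, c, v, rfl, hu⟩ := exists_cons_of_lt_length (l := p) (i := i) (by omega)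
        simp [run, act_cup hu, act_cross_succ hu] at hrun
        exact ⟨[cup (i + 1) b, cross i (!s)], rfl, .slide_cup i b s, by
          simp [run, act_cup_succ hu, act_cross hu, ← hrun]⟩
      · rintro W p q hW hp hrun
        obtain ⟨x, W₁, rfl, hx, hW₁⟩ := List.map_eq_cons_iff.1 hW
        obtain ⟨b, rfl⟩ := forget_eq_cup.1 hx
        obtain ⟨y, W₂, rfl, hy, hW₂⟩ := List.map_eq_cons_iff.1 hW₁
        obtain rfl := forget_eq_cross.1 hy
        obtain rfl := List.map_eq_nil_iff.1 hW₂
        obtain ⟨u, c, v, rfl, hu⟩ := exists_cons_of_lt_length (l := p) (i := i) (by omega)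
        simp [run, act_cup_succ hu, act_cross hu] at hrun
        exact ⟨[cup i b, cross (i + 1) s], rfl, .slide_cup i b s, by
          simp [run, act_cup hu, act_cross_succ hu, ← hrun]⟩
    | slide_cap i s =>
      simp only [Fits, Slice.pos, Slice.inputs, Slice.outputs] at hl
      constructor
      · rintro W p q hW hp hrun
        obtain ⟨x, W₁, rfl, hx, hW₁⟩ := List.map_eq_cons_iff.1 hW
        obtain rfl := forget_eq_cross.1 hx
        obtain ⟨y, W₂, rfl, hy, hW₂⟩ := List.map_eq_cons_iff.1 hW₁
        obtain rfl := forget_eq_cap.1 hy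
        obtain rfl := List.map_eq_nil_iff.1 hW₂
        obtain ⟨u, c, v, rfl, hu⟩ := exists_cons_of_lt_length (l := p) (i := i) (by omega)
        obtain ⟨d, e, v, rfl⟩ := exists_cons_cons_of_length (l := v)
          (by simp at hp; omega)
        simp [run, act_cap hu, act_cross_succ hu] at hrun
        exact ⟨[cross i (!s), cap (i + 1)], rfl, .slide_cap i s, by
          simp [run, act_cap_succ hu, act_cross hu, ← hrun]⟩
      · rintro W p q hW hp hrun
        obtain ⟨x, W₁, rfl, hx, hW₁⟩ := List.map_eq_cons_iff.1 hW
        obtain rfl := forget_eq_cross.1 hx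
        obtain ⟨y, W₂, rfl, hy, hW₂⟩ := List.map_eq_cons_iff.1 hW₁
        obtain rfl := forget_eq_cap.1 hy
        obtain rfl := List.map_eq_nil_iff.1 hW₂
        obtain ⟨u, c, v, rfl, hu⟩ := exists_cons_of_lt_length (l := p) (i := i) (by omega)
        obtain ⟨d, e, v, rfl⟩ := exists_cons_cons_of_length (l := v)
          (by simp at hp; omega)
        simp [run, act_cap_succ hu, act_cross hu] at hrun
        exact ⟨[cross (i + 1) s, cap i], rfl, .slide_cap i s, by
          simp [run, act_cap hu, act_cross_succ hu, ← hrun]⟩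
    | reidemeister1_right i a s =>
      simp only [Fits, Slice.pos, Slice.inputs, Slice.outputs] at hl
      constructor
      · rintro W p q hW hp hrun
        obtain ⟨x, W₁, rfl, hx, hW₁⟩ := List.map_eq_cons_iff.1 hW
        obtain ⟨b, rfl⟩ := forget_eq_cup.1 hx
        obtain ⟨y, W₂, rfl, hy, hW₂⟩ := List.map_eq_cons_iff.1 hW₁
        obtain rfl := forget_eq_cross.1 hy
        obtain ⟨z, W₃, rfl, hz, hW₃⟩ := List.map_eq_cons_iff.1 hW₂
        obtain rfl := forget_eq_cap.1 hz
        obtain rfl := List.map_eq_nil_iff.1 hW₃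
        obtain ⟨u, c, v, rfl, hu⟩ := exists_cons_of_lt_length (l := p) (i := i) (by omega)
        simp [run, act_cup_succ hu, act_cross hu, act_cap_succ hu] at hrun
        exact ⟨[], rfl, .reidemeister1_right i b s, by simp [run, ← hrun]⟩
      · rintro W p q hW hp hrun
        obtain rfl := List.map_eq_nil_iff.1 hW
        obtain ⟨u, c, v, rfl, hu⟩ := exists_cons_of_lt_length (l := p) (i := i) (by omega)
        simp [run] at hrun
        exact ⟨[cup (i + 1) c, cross i s, cap (i + 1)], rfl, .reidemeister1_right i c s, by
          simp [run, act_cup_succ hu, act_cross hu, act_cap_succ hu, ← hrun]⟩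
    | reidemeister1_left i a s =>
      simp only [Fits, Slice.pos, Slice.inputs, Slice.outputs] at hl
      constructor
      · rintro W p q hW hp hrun
        obtain ⟨x, W₁, rfl, hx, hW₁⟩ := List.map_eq_cons_iff.1 hW
        obtain ⟨b, rfl⟩ := forget_eq_cup.1 hx
        obtain ⟨y, W₂, rfl, hy, hW₂⟩ := List.map_eq_cons_iff.1 hW₁
        obtain rfl := forget_eq_cross.1 hy
        obtain ⟨z, W₃, rfl, hz, hW₃⟩ := List.map_eq_cons_iff.1 hW₂
        obtain rfl := forget_eq_cap.1 hz
        obtain rfl := List.map_eq_nil_iff.1 hW₃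
        obtain ⟨u, c, v, rfl, hu⟩ := exists_cons_of_lt_length (l := p) (i := i) (by omega)
        simp [run, act_cup hu, act_cross_succ hu, act_cap hu] at hrun
        exact ⟨[], rfl, .reidemeister1_left i b s, by simp [run, ← hrun]⟩
      · rintro W p q hW hp hrun
        obtain rfl := List.map_eq_nil_iff.1 hW
        obtain ⟨u, c, v, rfl, hu⟩ := exists_cons_of_lt_length (l := p) (i := i) (by omega)
        simp [run] at hrun
        exact ⟨[cup i (!c), cross (i + 1) s, cap i], rfl, .reidemeister1_left i (!c) s, by
          simp [run, act_cup hu, act_cross_succ hu, act_cap hu, ← hrun]⟩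
    | reidemeister2 i s =>
      simp only [Fits, Slice.pos, Slice.inputs, Slice.outputs] at hl
      constructor
      · rintro W p q hW hp hrun
        obtain ⟨x, W₁, rfl, hx, hW₁⟩ := List.map_eq_cons_iff.1 hW
        obtain rfl := forget_eq_cross.1 hx
        obtain ⟨y, W₂, rfl, hy, hW₂⟩ := List.map_eq_cons_iff.1 hW₁
        obtain rfl := forget_eq_cross.1 hy
        obtain rfl := List.map_eq_nil_iff.1 hW₂
        obtain ⟨u, c, v, rfl, hu⟩ := exists_cons_of_lt_length (l := p) (i := i) (by omega)
        obtain ⟨d, v, rfl⟩ := List.exists_cons_of_length_pos (l := v) (by simp at hp; omega)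
        simp [run, act_cross hu] at hrun
        exact ⟨[], rfl, .reidemeister2 i s, by simp [run, ← hrun]⟩
      · rintro W p q hW hp hrun
        obtain rfl := List.map_eq_nil_iff.1 hW
        obtain ⟨u, c, v, rfl, hu⟩ := exists_cons_of_lt_length (l := p) (i := i) (by omega)
        obtain ⟨d, v, rfl⟩ := List.exists_cons_of_length_pos (l := v) (by simp at hp; omega)
        simp [run] at hrun
        exact ⟨[cross i s, cross i (!s)], rfl, .reidemeister2 i s, by
          simp [run, act_cross hu, ← hrun]⟩
    | reidemeister3 i s t v h =>
      simp only [Fits, Slice.pos, Slice.inputs, Slice.outputs] at hl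
      constructor
      · rintro W p q hW hp hrun
        obtain ⟨x, W₁, rfl, hx, hW₁⟩ := List.map_eq_cons_iff.1 hW
        obtain rfl := forget_eq_cross.1 hx
        obtain ⟨y, W₂, rfl, hy, hW₂⟩ := List.map_eq_cons_iff.1 hW₁
        obtain rfl := forget_eq_cross.1 hy
        obtain ⟨z, W₃, rfl, hz, hW₃⟩ := List.map_eq_cons_iff.1 hW₂
        obtain rfl := forget_eq_cross.1 hz
        obtain rfl := List.map_eq_nil_iff.1 hW₃
        obtain ⟨u, c, r, rfl, hu⟩ := exists_cons_of_lt_length (l := p) (i := i) (by omega)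
        obtain ⟨d, e, r, rfl⟩ := exists_cons_cons_of_length (l := r)
          (by simp at hp; omega)
        simp [run, act_cross hu, act_cross_succ hu] at hrun
        exact ⟨_, rfl, .reidemeister3 i s t v h, by
          simp [run, act_cross hu, act_cross_succ hu, ← hrun]⟩
      · rintro W p q hW hp hrun
        obtain ⟨x, W₁, rfl, hx, hW₁⟩ := List.map_eq_cons_iff.1 hW
        obtain rfl := forget_eq_cross.1 hx
        obtain ⟨y, W₂, rfl, hy, hW₂⟩ := List.map_eq_cons_iff.1 hW₁
        obtain rfl := forget_eq_cross.1 hy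
        obtain ⟨z, W₃, rfl, hz, hW₃⟩ := List.map_eq_cons_iff.1 hW₂
        obtain rfl := forget_eq_cross.1 hz
        obtain rfl := List.map_eq_nil_iff.1 hW₃
        obtain ⟨u, c, r, rfl, hu⟩ := exists_cons_of_lt_length (l := p) (i := i) (by omega)
        obtain ⟨d, e, r, rfl⟩ := exists_cons_cons_of_length (l := r)
          (by simp at hp; omega)
        simp [run, act_cross hu, act_cross_succ hu] at hrun
        exact ⟨_, rfl, .reidemeister3 i s t v h, by
          simp [run, act_cross hu, act_cross_succ hu, ← hrun]⟩
  constructor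
  · intro W p q hW hp hrun
    obtain ⟨W', h1, h2, h3⟩ := key.1 W p q hW hp hrun
    exact ⟨W', h1, .rel _ _ ⟨hrun, h3, [], [], W, W', h2, by simp, by simp⟩⟩
  · intro W p q hW hp hrun
    obtain ⟨W', h1, h2, h3⟩ := key.2 W p q hW hp hrun
    exact ⟨W', h1, .symm _ _ (.rel _ _ ⟨h3, hrun, [], [], W', W, h2, by simp, by simp⟩)⟩

/-- Both directions are carried through the induction together, since `symm` interchanges them. -/
theorem Iso.lifts {n m : ℕ} {w w' : List (Slice Unit)} (h : Iso n m w w') :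
    Lifts n w w' ∧ Lifts n w' w := by
  induction h with
  | move h hl hr => exact lifts_move h hl hr
  | refl h => exact ⟨fun W l l' hW _ _ => ⟨W, hW, .refl _⟩, fun W l l' hW _ _ => ⟨W, hW, .refl _⟩⟩
  | symm h ih => exact ih.symm
  | trans h h' ih ih' =>
    have key : ∀ {n : ℕ} {w w' w'' : List (Slice Unit)}, Lifts n w w' → Lifts n w' w'' →
        Lifts n w w'' := by
      intro n w w' w'' h h' W l l' hW hl hrun
      obtain ⟨W', hW', hi⟩ := h W l l' hW hl hrun
      obtain ⟨W'', hW'', hi'⟩ := h' W' l l' hW' hl (hi.run_iff.1 hrun)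
      exact ⟨W'', hW'', .trans _ _ _ hi hi'⟩
    exact ⟨key ih.1 ih'.1, key ih'.2 ih.2⟩
  | append h h' ih ih' =>
    have key : ∀ {n k : ℕ} {u u' v v' : List (Slice Unit)}, Fits u n k → Lifts n u u' →
        Lifts k v v' → Lifts n (u ++ v) (u' ++ v') := by
      intro n k u u' v v' hf h h' W l l' hW hl hrun
      obtain ⟨U, V, rfl, rfl, rfl⟩ := List.map_eq_append_iff.1 hW
      obtain ⟨p, hU, hV⟩ := run_append_eq_some.1 hrun
      -- The lift of the upper factor starts from the strands that the oriented lower factor really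
      -- produces; their number is determined by the unoriented word.
      have hp : p.length = k := by
        have := fits_of_run hU
        rw [hl] at this
        exact this.unique hf
      obtain ⟨U', hU', hi⟩ := h U l p rfl hl hU
      obtain ⟨V', hV', hi'⟩ := h' V p l' rfl hp hV
      exact ⟨U' ++ V', by simp [hU', hV'], .trans _ _ _ (hi.append_right hV)
        (hi'.append_left (hi.run_iff.1 hU))⟩
    exact ⟨key h.fits.1 ih.1 ih'.1, key h.fits.2 ih.2 ih'.2⟩

/-- This is the bridge from isotopies of unoriented words to links: the orientation of `D` is
transported, so the link stays the same. -/
theorem Iso.exists_diagram {w w' : List (Slice Unit)} (h : Iso 0 0 w w') {L : Link}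
    {D : LinkDiagram} (hD : L.HasDiagram D) (hw : D.word.map forget = w) :
    ∃ D' : LinkDiagram, L.HasDiagram D' ∧ D'.word.map forget = w' := by
  obtain ⟨W, hW, hi⟩ := h.lifts.1 D.word [] [] hw rfl D.closed
  have hrun := hi.run_iff.1 D.closed
  exact ⟨⟨W, hrun⟩, (hi.link_eq D.closed hrun).symm.trans hD, hW⟩

/-! ### Checkerboard colourings and alternating diagrams -/

section Checkered

variable {α : Type}

/-- All crossings are of the same type with respect to the checkerboard colouring of the regions,
in which the region to the right of strand number `i` has the colour `i` modulo `2`. -/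
def Checkered (c : Bool) (w : List (Slice α)) : Prop :=
  ∀ i s, cross i s ∈ w → s = xor c i.bodd

/-- A side (`true` = above) of a point of a diagram. -/
abbrev Side : Type := ℕ × ℕ × Bool

/-- The other side of the same point. -/
def Side.opp (P : Side) : Side := (P.1, P.2.1, !P.2.2)

/-- The side of a point that is reached by leaving a point on the given side, if this does not
lead into a crossing. -/
def partner (w : List (Slice α)) : Side → Option Side
  | (k, j, true) =>
    match w[k]? with
    | some (cup i _) => if j < i then some (k + 1, j, false) else some (k + 1, j + 2, false)
    | some (cap i) =>
      if j < i then some (k + 1, j, false) else if j = i then some (k, i + 1, true)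
      else if j = i + 1 then some (k, i, true) else some (k + 1, j - 2, false)
    | some (cross i _) => if j < i ∨ i + 2 ≤ j then some (k + 1, j, false) else none
    | none => none
  | (0, _, false) => none
  | (k + 1, j, false) =>
    match w[k]? with
    | some (cup i _) =>
      if j < i then some (k, j, true) else if j = i then some (k + 1, i + 1, false)
      else if j = i + 1 then some (k + 1, i, false) else some (k, j - 2, true)
    | some (cap i) => if j < i then some (k, j, true) else some (k, j + 2, true)
    | some (cross i _) => if j < i ∨ i + 2 ≤ j then some (k, j, true) else none
    | none => none

/-- The two sides are joined by a piece of strand that does not meet a crossing. -/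
def Arc (w : List (Slice α)) (P Q : Side) : Prop := partner w P = some Q ∧ partner w Q = some P

theorem exists_arc {w : List (Slice α)} {p q : ℕ × ℕ} (h : Joined w p q) :
    ∃ d d', Arc w (p.1, p.2, d) (q.1, q.2, d') := by
  cases h with
  | cup h => exact ⟨false, false, by simp [Arc, partner, h]⟩
  | cup_left h hj => exact ⟨true, false, by simp [Arc, partner, h, hj]⟩
  | cup_right h hj =>
    refine ⟨true, false, ?_⟩
    simp only [Arc, partner, h]
    grind
  | cap h => exact ⟨true, true, by simp [Arc, partner, h]⟩
  | cap_left h hj => exact ⟨true, false, by simp [Arc, partner, h, hj]⟩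
  | cap_right h hj =>
    refine ⟨true, false, ?_⟩
    simp only [Arc, partner, h]
    grind
  | cross_left h hj => exact ⟨true, false, by simp [Arc, partner, h, hj]⟩
  | cross_right h hj => exact ⟨true, false, by simp [Arc, partner, h, hj]⟩

/-- The direction of travel on leaving a point on a given side, relative to the orientation of
the edges in which strands in even position run upwards. -/
def Side.sense (P : Side) : Bool := xor P.2.1.bodd P.2.2

theorem Side.sense_opp (P : Side) : (Side.opp P).sense = !P.sense := by
  simp [sense, opp]

theorem bodd_sub_two {j : ℕ} (h : 2 ≤ j) : (j - 2).bodd = j.bodd := by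
  obtain ⟨k, rfl⟩ := Nat.exists_eq_add_of_le' h
  simp

/-- A vertical piece of strand changes the position by `0` or `2` and runs from an upper side to a
lower one; a cup or cap changes the position by `1` and joins two equal sides. In either case
exactly one of the two parities flips. -/
theorem sense_partner {w : List (Slice α)} {P Q : Side} (h : partner w P = some Q) :
    Q.sense = !P.sense := by
  obtain ⟨k, j, d⟩ := P
  cases d
  · cases k with
    | zero => simp [partner] at h
    | succ k =>
      simp only [partner] at h
      split at h <;> (try split_ifs at h) <;>
        simp only [Option.some.injEq, reduceCtorEq] at h <;> subst h <;>
        simp only [Side.sense] <;> (try subst_vars) <;> (try simp)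
      rw [bodd_sub_two (by omega)]
  · simp only [partner] at h
    split at h <;> (try split_ifs at h) <;>
      simp only [Option.some.injEq, reduceCtorEq] at h <;> subst h <;>
      simp only [Side.sense] <;> (try subst_vars) <;> (try simp)
    rw [bodd_sub_two (by omega)]

/-- The side of the end of a crossing that faces the crossing. -/
def CrossingEnd.inner {w : List (Slice α)} (e : CrossingEnd w) : Side :=
  (e.point.1, e.point.2, !e.top)

theorem CrossingEnd.partner_inner {w : List (Slice α)} (e : CrossingEnd w) :
    partner w e.inner = none := by
  obtain ⟨k, i, s, t, r, h⟩ := e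
  cases t <;> cases r <;> simp [inner, point, partner, h]

/-- The sides on which points are left when one travels along an edge, starting at `e`. -/
inductive CrossingEnd.Leaves {w : List (Slice α)} (e : CrossingEnd w) : Side → Prop
  | start : e.Leaves e.inner.opp
  | step {P Q : Side} (h : e.Leaves P) (hPQ : Arc w P Q) : e.Leaves Q.opp

theorem CrossingEnd.Leaves.sense_eq {w : List (Slice α)} {e : CrossingEnd w} {P : Side}
    (h : e.Leaves P) : P.sense = !e.inner.sense := by
  induction h with
  | start => rw [Side.sense_opp]
  | step h hPQ ih => rw [Side.sense_opp, sense_partner hPQ.1, ih, Bool.not_not]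

theorem Side.opp_opp (P : Side) : Side.opp (Side.opp P) = P := by simp [opp]

/-- At a visited point an arc either continues the journey or goes back. As `partner` is a function,
an arc going back is the one just travelled and leads to a visited point; at the start there is
none, because that side faces the crossing. -/
theorem CrossingEnd.Leaves.of_arc {w : List (Slice α)} {e : CrossingEnd w} {p q : ℕ × ℕ}
    {d d₁ d₂ : Bool} (h : e.Leaves (p.1, p.2, d)) (ha : Arc w (p.1, p.2, d₁) (q.1, q.2, d₂)) :
    ∃ d', e.Leaves (q.1, q.2, d') := by
  by_cases hd : d₁ = d
  · subst hd
    exact ⟨!d₂, h.step ha⟩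
  · obtain rfl : d₁ = !d := by cases d <;> cases d₁ <;> simp_all
    generalize hP : ((p.1, p.2, d) : Side) = P at h
    have hP' : ((p.1, p.2, !d) : Side) = Side.opp P := by rw [← hP]; rfl
    rw [hP'] at ha
    cases h with
    | start =>
      rw [Side.opp_opp] at ha
      simpa [e.partner_inner] using ha.1
    | step h hPQ =>
      rw [Side.opp_opp] at ha
      have := ha.1.symm.trans hPQ.2
      simp only [Option.some.injEq] at this
      exact ⟨d₂, by rw [this]; exact h⟩

theorem CrossingEnd.exists_leaves {w : List (Slice α)} {e : CrossingEnd w} {p q : ℕ × ℕ}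
    (h : SameEdge w p q) : (∃ d, e.Leaves (p.1, p.2, d)) ↔ ∃ d, e.Leaves (q.1, q.2, d) := by
  induction h with
  | rel p q h =>
    obtain ⟨d₁, d₂, ha⟩ := exists_arc h
    exact ⟨fun ⟨d, hd⟩ => hd.of_arc ha, fun ⟨d, hd⟩ => hd.of_arc ⟨ha.2, ha.1⟩⟩
  | refl => rfl
  | symm _ _ _ ih => exact ih.symm
  | trans _ _ _ _ _ ih ih' => exact ih.trans ih'

/-- With even positions oriented upwards, the two incoming ends of a crossing are opposite, so they
belong to the same strand: that from bottom left to top right if the position is even, the other one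
if it is odd. In a diagram of one type, either all incoming ends are over or all are under. -/
theorem Checkered.isOver_eq {c : Bool} {w : List (Slice α)} (hw : Checkered c w)
    (e : CrossingEnd w) : e.isOver = xor c (!e.inner.sense) := by
  obtain ⟨k, i, s, t, r, h⟩ := e
  have := hw i s (List.mem_of_getElem? h)
  subst this
  simp only [CrossingEnd.isOver, CrossingEnd.inner, CrossingEnd.point, Side.sense, Nat.bodd_add]
  cases t <;> cases r <;> cases c <;> cases i.bodd <;> rfl

/-- Travelling along the edge from `e` keeps the sense, so an edge that is outgoing at `e` is
incoming at `e'` and conversely; by `Checkered.isOver_eq` it changes between over and under. -/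
theorem Checkered.alternating {c : Bool} {w : List (Slice α)} (hw : Checkered c w) :
    AlternatingWord w := by
  intro e e' hne hee'
  obtain ⟨d, hd⟩ := (CrossingEnd.exists_leaves (e := e) hee').1 ⟨e.top, by
    simpa [CrossingEnd.inner, Side.opp] using CrossingEnd.Leaves.start (e := e)⟩
  -- If the journey left the point of `e'` away from its crossing, it would have started there, or
  -- come out of that crossing, which no arc does. The first is excluded by `e ≠ e'`.
  by_cases hdt : d = e'.top
  · exfalso
    have hin : ((e'.point.1, e'.point.2, d) : Side) = e'.inner.opp := by
      simp [CrossingEnd.inner, Side.opp, hdt]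
    rw [hin] at hd
    generalize hP : e'.inner.opp = P at hd
    have hP' : e'.inner = P.opp := by rw [← hP, Side.opp_opp]
    cases hd with
    | start =>
      rw [Side.opp_opp] at hP'
      apply hne
      obtain ⟨k, i, s, t, r, h⟩ := e
      obtain ⟨k', i', s', t', r', h'⟩ := e'
      simp only [CrossingEnd.inner, CrossingEnd.point, Prod.mk.injEq] at hP'
      obtain ⟨h1, h2, h3⟩ := hP'
      obtain rfl : t' = t := by simpa using h3
      obtain rfl : k' = k := by omega
      rw [h] at h'
      simp only [Option.some.injEq, Slice.cross.injEq] at h'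
      obtain ⟨rfl, rfl⟩ := h'
      obtain rfl : r' = r := by cases r <;> cases r' <;> simp_all
      rfl
    | step h hPQ =>
      rw [Side.opp_opp] at hP'
      rw [← hP'] at hPQ
      simpa [e'.partner_inner] using hPQ.2
  · have hin : ((e'.point.1, e'.point.2, d) : Side) = e'.inner := by
      simp only [CrossingEnd.inner, Prod.mk.injEq, true_and]
      cases d <;> cases h : e'.top <;> simp_all
    rw [hin] at hd
    rw [hw.isOver_eq, hw.isOver_eq, hd.sense_eq]
    cases c <;> cases e.inner.sense <;> simp

theorem Checkered.append {c : Bool} {u v : List (Slice α)} (hu : Checkered c u)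
    (hv : Checkered c v) : Checkered c (u ++ v) := by
  intro i s h
  rcases List.mem_append.1 h with h | h
  exacts [hu i s h, hv i s h]

theorem checkered_append {c : Bool} {u v : List (Slice α)} :
    Checkered c (u ++ v) ↔ Checkered c u ∧ Checkered c v := by
  simp only [Checkered, List.mem_append, or_imp, forall_and]

theorem checkered_cons {c : Bool} {g : Slice α} {w : List (Slice α)} :
    Checkered c (g :: w) ↔ Checkered c [g] ∧ Checkered c w :=
  checkered_append (u := [g])

theorem checkered_cup {c : Bool} {i : ℕ} {a : α} : Checkered c [cup i a] := by simp [Checkered]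

theorem checkered_cap {c : Bool} {i : ℕ} : Checkered c [(cap i : Slice α)] := by simp [Checkered]

theorem checkered_cross {c s : Bool} {i : ℕ} :
    Checkered c [(cross i s : Slice α)] ↔ s = xor c i.bodd := by
  simp [Checkered]

theorem Checkered.shift {c : Bool} {w : List (Slice α)} (h : Checkered c w) (k : ℕ) :
    Checkered (xor c k.bodd) (w.map (Slice.shift k)) := by
  intro i s hi
  obtain ⟨g, hg, hgi⟩ := List.mem_map.1 hi
  cases g <;> simp only [Slice.shift, reduceCtorEq, Slice.cross.injEq] at hgi
  obtain ⟨rfl, rfl⟩ := hgi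
  rw [h _ _ hg, Nat.bodd_add]
  generalize Nat.bodd _ = x
  cases c <;> cases x <;> cases k.bodd <;> rfl

end Checkered

theorem checkered_forget {c : Bool} {w : List (Slice Bool)} :
    Checkered c (w.map forget) ↔ Checkered c w := by
  have : ∀ i s, (cross i s : Slice Unit) ∈ w.map forget ↔ (cross i s : Slice Bool) ∈ w := by
    intro i s
    simp only [List.mem_map, forget_eq_cross, exists_eq_right]
  simp only [Checkered, this]

/-! ### Isotopies that move whole blocks -/

theorem iso_exchange_slice {g : Slice Unit} {S : List (Slice Unit)} {p q j : ℕ} (hS : Fits S p q)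
    (hj : g.pos ≤ j) (e : ℕ) :
    Iso (j + g.inputs + p + e) (j + g.outputs + q + e) (g :: S.map (shift (j + g.outputs)))
      (S.map (shift (j + g.inputs)) ++ [g]) := by
  induction S generalizing p with
  | nil =>
    simp only [Fits] at hS
    refine .refl ?_
    simp only [List.map_nil, Fits]
    omega
  | cons h S ih =>
    obtain ⟨h1, h2⟩ := hS
    have h3 : Iso (j + g.inputs + p + e) (j + g.outputs + (p - h.inputs + h.outputs) + e)
        [g, h.shift (j + g.outputs)] [h.shift (j + g.inputs), g] := by
      rw [← shift_shift, ← shift_shift]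
      refine .move (.exchange g (h.shift j) (by simp; omega)) ?_ ?_ <;>
        simp only [Fits, pos_shift, inputs_shift, outputs_shift] <;> omega
    have h4 : Iso (j + g.inputs + p + e) (j + g.inputs + (p - h.inputs + h.outputs) + e)
        [h.shift (j + g.inputs)] [h.shift (j + g.inputs)] := by
      refine .refl ?_
      simp only [Fits, pos_shift, inputs_shift, outputs_shift]
      omega
    have h5 := h2.shift (j + g.outputs)
    have h6 : Iso (j + g.outputs + (p - h.inputs + h.outputs) + e) (j + g.outputs + q + e)
        (S.map (shift (j + g.outputs))) (S.map (shift (j + g.outputs))) := by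
      refine .refl ?_
      convert (h2.shift (j + g.outputs)).widen e using 1 <;> omega
    simpa using (h3.append h6).trans (h4.append (ih h2))

/-- `T` lies entirely to the left of `S`, so their heights may be exchanged slice by slice. The
number `e` counts idle strands on the right. -/
theorem iso_exchange {T S : List (Slice Unit)} {p q p' q' j k : ℕ} (hT : Fits T p q)
    (hS : Fits S p' q') (hj : k ≤ j) (e : ℕ) :
    Iso (j + p + p' + e) (j + q + q' + e) (T.map (shift k) ++ S.map (shift (j + q)))
      (S.map (shift (j + p)) ++ T.map (shift k)) := by
  induction T generalizing p with
  | nil =>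
    simp only [Fits] at hT
    subst hT
    simp only [List.map_nil, List.nil_append, List.append_nil]
    refine .refl ?_
    convert (hS.shift (j + p)).widen e using 1 <;> omega
  | cons g T ih =>
    obtain ⟨h1, h2⟩ := hT
    have h3 := iso_exchange_slice (g := g.shift k) (j := j + p - g.inputs) hS
      (by simp; omega) e
    simp only [inputs_shift, outputs_shift] at h3
    have e1 : j + p - g.inputs + g.inputs = j + p := by omega
    have e2 : j + p - g.inputs + g.outputs = j + (p - g.inputs + g.outputs) := by omega
    rw [e1, e2] at h3
    have h4 : Iso (j + p + p' + e) (j + (p - g.inputs + g.outputs) + p' + e) [g.shift k]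
        [g.shift k] := by
      refine .refl ?_
      simp only [Fits, pos_shift, inputs_shift, outputs_shift]
      omega
    have h5 : Iso (j + (p - g.inputs + g.outputs) + q' + e) (j + q + q' + e)
        (T.map (shift k)) (T.map (shift k)) := by
      refine .refl ?_
      convert (h2.shift k).widen ((j - k) + q' + e) using 1 <;> omega
    have := (h4.append (ih h2)).trans (by simpa using h3.append h5)
    simpa using this

/-- The first Reidemeister move is only given for a curl on a strand. A zigzag is inserted beside
the crossing; after exchanging heights, the crossing slides through the new cup and becomes such a
curl. -/
theorem iso_curl_cap (i e : ℕ) (s : Bool) :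
    Iso (2 + i + e) (0 + i + e) [cross i s, cap i] [cap i] := by
  have base : Iso 2 0 [cross 0 s, cap 0] [cap 0] := by
    have f : ∀ {w : List (Slice Unit)} {n m : ℕ}, Fits w n m → Iso n m w w := .refl
    have h1 : Iso 2 0 [cup 1 (), cap 2, cross 0 s, cap 0] [cross 0 s, cap 0] :=
      (Iso.move (n := 2) (m := 2) (.zigzag_left 1 ()) (by simp [Fits, pos, inputs, outputs])
        (by simp [Fits])).append (f (w := [cross 0 s, cap 0]) (by simp [Fits, pos, inputs, outputs]))
    have h2 : Iso 2 0 [cup 1 (), cross 0 s, cap 2, cap 0] [cup 1 (), cap 2, cross 0 s, cap 0] :=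
      ((f (w := [cup 1 ()]) (m := 4) (by simp [Fits, pos, inputs, outputs])).append
        (Iso.move (m := 2) (.exchange (cross 0 s) (cap 0) le_rfl)
          (by simp [Fits, pos, inputs, outputs, Slice.shift])
          (by simp [Fits, pos, inputs, outputs, Slice.shift]))).append
        (f (w := [cap 0]) (by simp [Fits, pos, inputs, outputs]))
    have h3 : Iso 2 0 [cup 1 (), cross 0 s, cap 0, cap 0] [cup 1 (), cross 0 s, cap 2, cap 0] :=
      (f (w := [cup 1 (), cross 0 s]) (m := 4) (by simp [Fits, pos, inputs, outputs])).append
        (Iso.move (m := 0) (.exchange (cap 0) (cap 0) le_rfl)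
          (by simp [Fits, pos, inputs, outputs])
          (by simp [Fits, pos, inputs, outputs]))
    have h4 : Iso 2 0 [cup 0 (), cross 1 (!s), cap 0, cap 0] [cup 1 (), cross 0 s, cap 0, cap 0] := by
      have := (Iso.move (n := 2) (m := 4) (.slide_cup 0 () (!s))
        (by simp [Fits, pos, inputs, outputs]) (by simp [Fits, pos, inputs, outputs])).append
        (f (w := [cap 0, cap 0]) (m := 0) (by simp [Fits, pos, inputs, outputs]))
      simpa using this
    have h5 : Iso 2 0 [cup 0 (), cross 1 (!s), cap 0, cap 0] [cap 0] :=
      (Iso.move (n := 2) (m := 2) (.reidemeister1_left 0 () (!s))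
        (by simp [Fits, pos, inputs, outputs]) (by simp [Fits])).append
        (f (w := [cap 0]) (by simp [Fits, pos, inputs, outputs]))
    exact h1.symm.trans (h2.symm.trans (h3.symm.trans (h4.symm.trans h5)))
  simpa [Slice.shift] using (base.shift i).widen e

theorem iso_curl_cup (i e : ℕ) (s : Bool) :
    Iso (0 + i + e) (2 + i + e) [cup i (), cross i s] [cup i ()] := by
  simpa [Slice.flip] using (iso_curl_cap i e (!s)).flip

/-! ### A calculus of isotopies -/

/-- The pieces of a diagram: slices, and boxes that stand for the word `T`, which takes `p` strands
to `q` strands, with `k` further strands to its left. -/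
inductive Piece : Type
  | cup (i : ℕ)
  | cap (i : ℕ)
  | cross (i : ℕ) (s : Bool)
  | box (T : List (Slice Unit)) (p q k : ℕ)

namespace Piece

/-- The piece without the strands to its left. -/
def core : Piece → List (Slice Unit)
  | cup _ => [.cup 0 ()]
  | cap _ => [.cap 0]
  | cross _ s => [.cross 0 s]
  | box T _ _ _ => T

/-- The number of strands to the left. -/
def pos : Piece → ℕ
  | cup i => i
  | cap i => i
  | cross i _ => i
  | box _ _ _ k => k

/-- The number of strands that enter from below. -/
def ins : Piece → ℕ
  | cup _ => 0
  | cap _ => 2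
  | cross _ _ => 2
  | box _ p _ _ => p

/-- The number of strands that leave at the top. -/
def outs : Piece → ℕ
  | cup _ => 2
  | cap _ => 0
  | cross _ _ => 2
  | box _ _ q _ => q

/-- The same piece with `k` strands to the left. -/
def place (k : ℕ) : Piece → Piece
  | cup _ => cup k
  | cap _ => cap k
  | cross _ s => cross k s
  | box T p q _ => box T p q k

/-- The word of a piece. -/
def word : Piece → List (Slice Unit)
  | cup i => [.cup i ()]
  | cap i => [.cap i]
  | cross i s => [.cross i s]
  | box T _ _ k => T.map (shift k)

/-- The numbers of strands of a box are right. -/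
def Ok : Piece → Prop
  | box T p q _ => Fits T p q
  | _ => True

theorem word_eq (t : Piece) : t.word = t.core.map (shift t.pos) := by
  cases t <;> simp [word, core, pos, shift]

theorem fits_core {t : Piece} (h : t.Ok) : Fits t.core t.ins t.outs := by
  cases t <;> simp_all [Ok, core, ins, outs, Fits, Slice.pos, inputs, outputs]

@[simp] theorem pos_place (t : Piece) (k : ℕ) : (t.place k).pos = k := by cases t <;> rfl
@[simp] theorem ins_place (t : Piece) (k : ℕ) : (t.place k).ins = t.ins := by cases t <;> rfl
@[simp] theorem outs_place (t : Piece) (k : ℕ) : (t.place k).outs = t.outs := by cases t <;> rfl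
@[simp] theorem core_place (t : Piece) (k : ℕ) : (t.place k).core = t.core := by cases t <;> rfl
theorem ok_place {t : Piece} {k : ℕ} : (t.place k).Ok ↔ t.Ok := by cases t <;> rfl

end Piece

/-! ### Moves on lists of pieces, and their soundness -/

/-- The word of a list of pieces. -/
def assemble : List Piece → List (Slice Unit)
  | [] => []
  | t :: w => t.word ++ assemble w

/-- The pieces fit together. -/
def Valid : List Piece → ℕ → ℕ → Prop
  | [], n, m => n = m
  | t :: w, n, m => t.Ok ∧ t.pos + t.ins ≤ n ∧ Valid w (n - t.ins + t.outs) m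

/-- The kinds of moves. -/
inductive MoveKind : Type
  | up
  | down
  | cancel
  | slide
  | curl
  | triangle

/-- Apply a move to the pieces at the beginning of a list. Here `up` moves the first piece up past
the second one, which lies to its right, and `down` likewise if the second one lies to its left. -/
def MoveKind.act : MoveKind → List Piece → Option (List Piece)
  | up, a :: b :: v =>
    if a.pos + a.outs ≤ b.pos then some (b.place (b.pos - a.outs + a.ins) :: a :: v) else none
  | down, a :: b :: v =>
    if b.pos + b.ins ≤ a.pos then some (b :: a.place (a.pos - b.ins + b.outs) :: v) else none
  | cancel, .cup i :: .cap j :: v => if j = i + 1 ∨ i = j + 1 then some v else none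
  | cancel, .cross i s :: .cross j t :: v => if i = j ∧ t = !s then some v else none
  | slide, .cup i :: .cross j s :: v =>
    if j = i + 1 ∨ i = j + 1 then some (.cup j :: .cross i (!s) :: v) else none
  | slide, .cross i s :: .cap j :: v =>
    if j = i + 1 ∨ i = j + 1 then some (.cross j (!s) :: .cap i :: v) else none
  | curl, .cup i :: .cross j _ :: v => if i = j then some (.cup i :: v) else none
  | curl, .cross i _ :: .cap j :: v => if i = j then some (.cap j :: v) else none
  | triangle, .cross i s :: .cross j t :: .cross k u :: v =>
    if (j = i + 1 ∨ i = j + 1) ∧ i = k ∧ (s = t ∨ t = u) then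
      some (.cross j u :: .cross i t :: .cross j s :: v) else none
  | _, _ => none

/-- Apply a move to the pieces from number `k` on. -/
def applyAt (m : MoveKind) : ℕ → List Piece → Option (List Piece)
  | 0, w => m.act w
  | k + 1, t :: w => (applyAt m k w).map (t :: ·)
  | _ + 1, [] => none

/-- Apply a list of moves. -/
def applyMoves : List (ℕ × MoveKind) → List Piece → Option (List Piece)
  | [], w => some w
  | (k, m) :: ms, w => (applyAt m k w).bind (applyMoves ms)

theorem Valid.fits {w : List Piece} {n m : ℕ} (h : Valid w n m) : Fits (assemble w) n m := by
  induction w generalizing n with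
  | nil => exact h
  | cons t w ih =>
    obtain ⟨h1, h2, h3⟩ := h
    refine fits_append.2 ⟨_, ?_, ih h3⟩
    rw [t.word_eq]
    convert ((Piece.fits_core h1).shift t.pos).widen (n - t.ins - t.pos) using 1 <;> omega

theorem iso_assemble_cons {u v w : List Piece} {n k m : ℕ} (h : Iso n k (assemble u) (assemble v))
    (hw : Valid w k m) : Iso n m (assemble (u ++ w)) (assemble (v ++ w)) := by
  have : ∀ u : List Piece, assemble (u ++ w) = assemble u ++ assemble w := by
    intro u
    induction u <;> simp_all [assemble]
  rw [this, this]
  exact h.append (.refl hw.fits)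

theorem iso_of_localMove {u v w : List Piece} {n k m : ℕ}
    (h : LocalMove (assemble u) (assemble v) ∨ LocalMove (assemble v) (assemble u))
    (hu : Valid u n k) (hv : Valid v n k) (hw : Valid w k m) :
    Iso n m (assemble (u ++ w)) (assemble (v ++ w)) := by
  refine iso_assemble_cons ?_ hw
  rcases h with h | h
  · exact .move h hu.fits hv.fits
  · exact (Iso.move h hv.fits hu.fits).symm

theorem MoveKind.iso_exchange {a b : Piece} {v : List Piece} {j n m : ℕ} (ha : a.Ok) (hb : b.Ok)
    (hab : a.pos ≤ j) (hn : j + a.ins + b.ins ≤ n)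
    (hv : Valid v (n - a.ins - b.ins + a.outs + b.outs) m) :
    Iso n m (assemble (a :: b.place (j + a.outs) :: v)) (assemble (b.place (j + a.ins) :: a :: v)) := by
  have h := Knots.iso_exchange (Piece.fits_core ha) (Piece.fits_core hb) hab
    (n - (j + a.ins + b.ins))
  refine iso_assemble_cons (u := [a, b.place (j + a.outs)]) (v := [b.place (j + a.ins), a]) ?_ hv
  simp only [assemble, Piece.word_eq, Piece.pos_place, Piece.core_place, List.append_nil]
  convert h using 1 <;> omega

theorem place_self (b : Piece) : b.place b.pos = b := by cases b <;> rfl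

/-- Soundness of a single move. It turns an explicit isotopy, even one around unspecified tangles
(`box`), into the evaluation of a list of moves. -/
theorem MoveKind.sound {k : MoveKind} {w w' : List Piece} {n m : ℕ} (h : k.act w = some w')
    (hw : Valid w n m) : Valid w' n m ∧ Iso n m (assemble w) (assemble w') := by
  unfold MoveKind.act at h
  split at h
  · rename_i a b v
    obtain ⟨h1, h2, h3, h4, h5⟩ := hw
    simp only [Option.ite_none_right_eq_some, Option.some.injEq] at h
    obtain ⟨h, rfl⟩ := h
    have key := MoveKind.iso_exchange (j := b.pos - a.outs) (n := n) (v := v) (m := m) h1 h3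
      (by omega) (by omega) (by convert h5 using 1; omega)
    rw [Nat.sub_add_cancel (by omega), place_self] at key
    refine ⟨⟨Piece.ok_place.2 h3, by simp; omega, h1, by simp; omega, ?_⟩, key⟩
    convert h5 using 1
    simp; omega
  · rename_i a b v
    obtain ⟨h1, h2, h3, h4, h5⟩ := hw
    simp only [Option.ite_none_right_eq_some, Option.some.injEq] at h
    obtain ⟨h, rfl⟩ := h
    have key := MoveKind.iso_exchange (j := a.pos - b.ins) (n := n) (v := v) (m := m) h3 h1
      (by omega) (by omega) (by convert h5 using 1; omega)
    rw [Nat.sub_add_cancel (by omega), place_self] at key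
    refine ⟨⟨h3, by omega, Piece.ok_place.2 h1, by simp; omega, ?_⟩, key.symm⟩
    convert h5 using 1
    simp; omega
  · rename_i i j v
    simp only [Option.ite_none_right_eq_some, Option.some.injEq] at h
    obtain ⟨h, rfl⟩ := h
    simp only [Valid, Piece.pos, Piece.ins, Piece.outs, Piece.Ok, true_and] at hw
    obtain ⟨h2, h4, h5⟩ := hw
    have hn : n - 0 + 2 - 2 + 0 = n := by omega
    rw [hn] at h5
    refine ⟨h5, iso_of_localMove (u := [.cup i, .cap j]) (v := []) (k := n) (.inl ?_) ?_ rfl h5⟩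
    · rcases h with rfl | rfl
      exacts [.zigzag_left _ _, .zigzag_right _ _]
    · simp only [Valid, Piece.pos, Piece.ins, Piece.outs, Piece.Ok, true_and]; omega
  · rename_i i s j t v
    simp only [Option.ite_none_right_eq_some, Option.some.injEq] at h
    obtain ⟨⟨rfl, rfl⟩, rfl⟩ := h
    simp only [Valid, Piece.pos, Piece.ins, Piece.outs, Piece.Ok, true_and] at hw
    obtain ⟨h2, h4, h5⟩ := hw
    have hn : n - 2 + 2 - 2 + 2 = n := by omega
    rw [hn] at h5
    refine ⟨h5, iso_of_localMove (u := [.cross i s, .cross i (!s)]) (v := []) (k := n)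
      (.inl (.reidemeister2 i s)) ?_ rfl h5⟩
    simp only [Valid, Piece.pos, Piece.ins, Piece.outs, Piece.Ok, true_and]; omega
  · rename_i i j s v
    simp only [Option.ite_none_right_eq_some, Option.some.injEq] at h
    obtain ⟨h, rfl⟩ := h
    simp only [Valid, Piece.pos, Piece.ins, Piece.outs, Piece.Ok, true_and] at hw
    obtain ⟨h2, h4, h5⟩ := hw
    refine ⟨?_, iso_of_localMove (u := [.cup i, .cross j s]) (v := [.cup j, .cross i (!s)])
      ?_ ?_ ?_ h5⟩
    · simp only [Valid, Piece.pos, Piece.ins, Piece.outs, Piece.Ok, true_and]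
      exact ⟨by omega, by omega, h5⟩
    · rcases h with rfl | rfl
      · exact .inl (.slide_cup i () s)
      · right
        simpa [assemble, Piece.word] using LocalMove.slide_cup j () (!s)
    · simp only [Valid, Piece.pos, Piece.ins, Piece.outs, Piece.Ok, true_and, and_true]; omega
    · simp only [Valid, Piece.pos, Piece.ins, Piece.outs, Piece.Ok, true_and, and_true]; omega
  · rename_i i s j v
    simp only [Option.ite_none_right_eq_some, Option.some.injEq] at h
    obtain ⟨h, rfl⟩ := h
    simp only [Valid, Piece.pos, Piece.ins, Piece.outs, Piece.Ok, true_and] at hw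
    obtain ⟨h2, h4, h5⟩ := hw
    refine ⟨?_, iso_of_localMove (u := [.cross i s, .cap j]) (v := [.cross j (!s), .cap i])
      ?_ ?_ ?_ h5⟩
    · simp only [Valid, Piece.pos, Piece.ins, Piece.outs, Piece.Ok, true_and]
      exact ⟨by omega, by omega, h5⟩
    · rcases h with rfl | rfl
      · right
        simpa [assemble, Piece.word] using LocalMove.slide_cap i (!s) (α := Unit)
      · exact .inl (.slide_cap j s)
    · simp only [Valid, Piece.pos, Piece.ins, Piece.outs, Piece.Ok, true_and, and_true]; omega
    · simp only [Valid, Piece.pos, Piece.ins, Piece.outs, Piece.Ok, true_and, and_true]; omega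
  · rename_i i j s v
    simp only [Option.ite_none_right_eq_some, Option.some.injEq] at h
    obtain ⟨rfl, rfl⟩ := h
    simp only [Valid, Piece.pos, Piece.ins, Piece.outs, Piece.Ok, true_and] at hw
    obtain ⟨h2, h4, h5⟩ := hw
    have hn : n - 0 + 2 - 2 + 2 = n - 0 + 2 := by omega
    rw [hn] at h5
    refine ⟨?_, iso_assemble_cons (u := [.cup i, .cross i s]) (v := [.cup i]) ?_ h5⟩
    · simp only [Valid, Piece.pos, Piece.ins, Piece.outs, Piece.Ok, true_and]
      exact ⟨by omega, h5⟩
    · change Iso n _ [Slice.cup i (), Slice.cross i s] [Slice.cup i ()]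
      convert iso_curl_cup i (n - i) s using 1 <;> omega
  · rename_i i s j v
    simp only [Option.ite_none_right_eq_some, Option.some.injEq] at h
    obtain ⟨rfl, rfl⟩ := h
    simp only [Valid, Piece.pos, Piece.ins, Piece.outs, Piece.Ok, true_and] at hw
    obtain ⟨h2, h4, h5⟩ := hw
    have hn : n - 2 + 2 - 2 + 0 = n - 2 + 0 := by omega
    rw [hn] at h5
    refine ⟨?_, iso_assemble_cons (u := [.cross i s, .cap i]) (v := [.cap i]) ?_ h5⟩
    · simp only [Valid, Piece.pos, Piece.ins, Piece.outs, Piece.Ok, true_and]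
      exact ⟨by omega, h5⟩
    · change Iso n _ [Slice.cross i s, Slice.cap i] [Slice.cap i]
      convert iso_curl_cap i (n - (i + 2)) s using 1 <;> omega
  · rename_i i s j t k u v
    simp only [Option.ite_none_right_eq_some, Option.some.injEq] at h
    obtain ⟨⟨h, rfl, hs⟩, rfl⟩ := h
    simp only [Valid, Piece.pos, Piece.ins, Piece.outs, Piece.Ok, true_and] at hw
    obtain ⟨h2, h4, h5, h6⟩ := hw
    refine ⟨?_, iso_of_localMove (u := [.cross i s, .cross j t, .cross i u])
      (v := [.cross j u, .cross i t, .cross j s]) ?_ ?_ ?_ h6⟩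
    · simp only [Valid, Piece.pos, Piece.ins, Piece.outs, Piece.Ok, true_and]
      exact ⟨by omega, by omega, by omega, h6⟩
    · rcases h with rfl | rfl
      · exact .inl (.reidemeister3 i s t u hs)
      · exact .inr (.reidemeister3 j u t s (by grind))
    · simp only [Valid, Piece.pos, Piece.ins, Piece.outs, Piece.Ok, true_and, and_true]; omega
    · simp only [Valid, Piece.pos, Piece.ins, Piece.outs, Piece.Ok, true_and, and_true]; omega
  · simp at h

theorem applyAt_sound {k : MoveKind} {i : ℕ} {w w' : List Piece} {n m : ℕ}
    (h : applyAt k i w = some w') (hw : Valid w n m) :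
    Valid w' n m ∧ Iso n m (assemble w) (assemble w') := by
  induction i generalizing w w' n with
  | zero => exact MoveKind.sound h hw
  | succ i ih =>
    cases w with
    | nil => simp [applyAt] at h
    | cons t w =>
      simp only [applyAt, Option.map_eq_some_iff] at h
      obtain ⟨v, hv, rfl⟩ := h
      obtain ⟨h1, h2, h3⟩ := hw
      obtain ⟨h4, h5⟩ := ih hv h3
      refine ⟨⟨h1, h2, h4⟩, Iso.append (.refl ?_) h5⟩
      simpa [assemble] using Valid.fits (w := [t]) ⟨h1, h2, rfl⟩

theorem applyMoves_sound {ms : List (ℕ × MoveKind)} {w w' : List Piece} {n m : ℕ}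
    (h : applyMoves ms w = some w') (hw : Valid w n m) :
    Valid w' n m ∧ Iso n m (assemble w) (assemble w') := by
  induction ms generalizing w with
  | nil =>
    simp only [applyMoves, Option.some.injEq] at h
    subst h
    exact ⟨hw, .refl hw.fits⟩
  | cons km ms ih =>
    simp only [applyMoves, Option.bind_eq_some_iff] at h
    obtain ⟨v, hv, h⟩ := h
    obtain ⟨h1, h2⟩ := applyAt_sound hv hw
    obtain ⟨h3, h4⟩ := ih h h1
    exact ⟨h3, h2.trans h4⟩

/-- Two diagrams that can be moved to a common one are isotopic. -/
theorem iso_of_moves (w w' : List Piece) (ms ms' : List (ℕ × MoveKind)) {n m : ℕ}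
    (hw : Valid w n m) (hw' : Valid w' n m) (hs : (applyMoves ms w).isSome)
    (h : applyMoves ms w = applyMoves ms' w') :
    Iso n m (assemble w) (assemble w') := by
  obtain ⟨v, hv⟩ := Option.isSome_iff_exists.1 hs
  exact (applyMoves_sound hv hw).2.trans (applyMoves_sound (h ▸ hv) hw').2.symm

/-! ### Isotopies of tangles -/

/-- The tangle whose ends SW, NW, NE, SE are the upper ends, from left to right, of the word `W`,
which has no lower ends. -/
def unhat (W : Tangle) : Tangle := W.map (shift 1) ++ [cap 0, cap 2]

theorem Fits.unhat {W : Tangle} (hW : Fits W 0 4) : Fits (Knots.unhat W) 2 2 := by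
  refine fits_append.2 ⟨6, (hW.shift 1).widen 1, ?_⟩
  simp [Fits, pos, inputs, outputs]

theorem Iso.unhat {W W' : Tangle} (h : Iso 0 4 W W') : Iso 2 2 (Knots.unhat W) (Knots.unhat W') :=
  ((h.shift 1).widen 1).append (.refl (by simp [Fits, pos, inputs, outputs]))

theorem iso_unhat_inf : Iso 2 2 (unhat [cup 0 (), cup 2 ()]) [] := by
  have := iso_of_moves (n := 2) (m := 2) [.cup 1, .cup 3, .cap 0, .cap 2] []
    [(0, .up), (1, .cancel), (0, .cancel)] []
    (by simp [Valid, Piece.Ok, Piece.pos, Piece.ins, Piece.outs])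
    (by simp [Valid]) rfl rfl
  simpa [assemble, Piece.word, unhat, shift] using this

theorem iso_unhat_zero : Iso 2 2 (unhat [cup 0 (), cup 1 ()]) [cap 0, cup 0 ()] := by
  have := iso_of_moves (n := 2) (m := 2) [.cup 1, .cup 2, .cap 0, .cap 2] [.cap 0, .cup 0]
    [(1, .down), (0, .cancel)] [(0, .down)]
    (by simp [Valid, Piece.Ok, Piece.pos, Piece.ins, Piece.outs])
    (by simp [Valid, Piece.Ok, Piece.pos, Piece.ins, Piece.outs]) rfl rfl
  simpa [assemble, Piece.word, unhat, shift] using this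

/-- Together with the next two isotopies this is the dictionary between crossings at the upper ends
and operations on tangles: position `1` is a twist on top, position `2` one on the right, position
`0` one on the left. At positions `0` and `2` the sign is reversed, because the crossing slides
through a cap. -/
theorem iso_unhat_append_cross {W : Tangle} (hW : Fits W 0 4) (s : Bool) :
    Iso 2 2 (unhat W ++ [cross 0 s]) (unhat (W ++ [cross 1 s])) := by
  have := iso_of_moves (n := 2) (m := 2) [.box W 0 4 1, .cap 0, .cap 2, .cross 0 s]
    [.box W 0 4 1, .cross 2 s, .cap 0, .cap 2] [(2, .down)] [(1, .down)]
    (by simp [Valid, Piece.Ok, Piece.pos, Piece.ins, Piece.outs, hW])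
    (by simp [Valid, Piece.Ok, Piece.pos, Piece.ins, Piece.outs, hW]) rfl rfl
  simpa [assemble, Piece.word, unhat, shift] using this

theorem iso_sum_unhat_cross {W : Tangle} (hW : Fits W 0 4) (s : Bool) :
    Iso 2 2 (Tangle.sum (unhat W) [cross 0 s]) (unhat (W ++ [cross 2 (!s)])) := by
  have := iso_of_moves (n := 2) (m := 2)
    [.cup 1, .box W 0 4 1, .cap 0, .cap 2, .cross 2 s, .cap 1]
    [.box W 0 4 1, .cross 3 (!s), .cap 0, .cap 2] [(0, .down), (1, .down), (2, .cancel)]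
    [(1, .down), (2, .slide)]
    (by simp [Valid, Piece.Ok, Piece.pos, Piece.ins, Piece.outs, hW])
    (by simp [Valid, Piece.Ok, Piece.pos, Piece.ins, Piece.outs, hW]) rfl (by cases s <;> rfl)
  simpa [assemble, Piece.word, unhat, shift, Tangle.sum] using this

theorem iso_sum_cross_unhat {W : Tangle} (hW : Fits W 0 4) (s : Bool) :
    Iso 2 2 (Tangle.sum [cross 0 s] (unhat W)) (unhat (W ++ [cross 0 (!s)])) := by
  have := iso_of_moves (n := 2) (m := 2)
    [.cup 1, .cross 0 s, .box W 0 4 3, .cap 2, .cap 4, .cap 1]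
    [.box W 0 4 1, .cross 1 (!s), .cap 0, .cap 2] [(1, .up), (0, .up), (2, .up), (1, .cancel)]
    [(1, .slide), (2, .up)]
    (by simp [Valid, Piece.Ok, Piece.pos, Piece.ins, Piece.outs, hW])
    (by simp [Valid, Piece.Ok, Piece.pos, Piece.ins, Piece.outs, hW]) rfl (by cases s <;> rfl)
  simpa [assemble, Piece.word, unhat, shift, Tangle.sum, -List.map_map] using this

theorem iso_inf_cross_zero (s : Bool) :
    Iso 0 4 [cup 0 (), cup 2 (), cross 0 s] [cup 0 (), cup 2 ()] := by
  have := iso_of_moves (n := 0) (m := 4) [.cup 0, .cup 2, .cross 0 s] [.cup 0, .cup 2]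
    [(0, .up), (1, .curl)] [(0, .up)]
    (by simp [Valid, Piece.Ok, Piece.pos, Piece.ins, Piece.outs])
    (by simp [Valid, Piece.Ok, Piece.pos, Piece.ins, Piece.outs]) rfl rfl
  simpa [assemble, Piece.word] using this

theorem iso_inf_cross_two (s : Bool) :
    Iso 0 4 [cup 0 (), cup 2 (), cross 2 s] [cup 0 (), cup 2 ()] := by
  have := iso_of_moves (n := 0) (m := 4) [.cup 0, .cup 2, .cross 2 s] [.cup 0, .cup 2]
    [(1, .curl)] []
    (by simp [Valid, Piece.Ok, Piece.pos, Piece.ins, Piece.outs])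
    (by simp [Valid, Piece.Ok, Piece.pos, Piece.ins, Piece.outs]) rfl rfl
  simpa [assemble, Piece.word] using this

theorem iso_zero_cross_one (s : Bool) :
    Iso 0 4 [cup 0 (), cup 1 (), cross 1 s] [cup 0 (), cup 1 ()] := by
  have := iso_of_moves (n := 0) (m := 4) [.cup 0, .cup 1, .cross 1 s] [.cup 0, .cup 1]
    [(1, .curl)] []
    (by simp [Valid, Piece.Ok, Piece.pos, Piece.ins, Piece.outs])
    (by simp [Valid, Piece.Ok, Piece.pos, Piece.ins, Piece.outs]) rfl rfl
  simpa [assemble, Piece.word] using this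

theorem iso_zero_cross_zero (s : Bool) :
    Iso 0 4 [cup 0 (), cup 1 (), cross 0 s] [cup 0 (), cup 2 (), cross 1 (!s)] := by
  have := iso_of_moves (n := 0) (m := 4) [.cup 0, .cup 1, .cross 0 s]
    [.cup 0, .cup 2, .cross 1 (!s)] [(1, .slide), (0, .down)] []
    (by simp [Valid, Piece.Ok, Piece.pos, Piece.ins, Piece.outs])
    (by simp [Valid, Piece.Ok, Piece.pos, Piece.ins, Piece.outs]) rfl rfl
  simpa [assemble, Piece.word] using this

theorem iso_zero_cross_two (s : Bool) :
    Iso 0 4 [cup 0 (), cup 1 (), cross 2 s] [cup 0 (), cup 2 (), cross 1 (!s)] := by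
  have := iso_of_moves (n := 0) (m := 4) [.cup 0, .cup 1, .cross 2 s]
    [.cup 0, .cup 2, .cross 1 (!s)] [(1, .slide)] []
    (by simp [Valid, Piece.Ok, Piece.pos, Piece.ins, Piece.outs])
    (by simp [Valid, Piece.Ok, Piece.pos, Piece.ins, Piece.outs]) rfl rfl
  simpa [assemble, Piece.word] using this

/-! ### Sums and reflections of tangles -/

theorem map_flip_map_shift (w : Tangle) (k : ℕ) :
    (w.map (shift k)).map Slice.flip = (w.map Slice.flip).map (shift k) := by
  simp [List.map_map, Function.comp_def, flip_shift]

theorem Fits.sum {T S : Tangle} (hT : Fits T 2 2) (hS : Fits S 2 2) :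
    Fits (Tangle.sum T S) 2 2 := by
  refine ⟨by simp [Slice.pos, inputs], fits_append.2 ⟨4, fits_append.2 ⟨4, hT.widen 2,
    hS.shift 2⟩, by simp [Fits, Slice.pos, inputs, outputs]⟩⟩

theorem Iso.sum {T T' S S' : Tangle} (hT : Iso 2 2 T T') (hS : Iso 2 2 S S') :
    Iso 2 2 (Tangle.sum T S) (Tangle.sum T' S') := by
  have h1 : Iso 2 4 [cup 1 ()] [cup 1 ()] := .refl (by simp [Fits, Slice.pos, inputs, outputs])
  have h2 : Iso 4 2 [cap 1] [cap 1] := .refl (by simp [Fits, Slice.pos, inputs, outputs])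
  exact h1.append (((hT.widen 2).append (hS.shift 2)).append h2)

theorem Iso.reflect {T T' : Tangle} (hT : Iso 2 2 T T') :
    Iso 2 2 (Tangle.reflect T) (Tangle.reflect T') := by
  have h1 : Iso 2 4 [cup 0 ()] [cup 0 ()] := .refl (by simp [Fits, Slice.pos, inputs, outputs])
  have h2 : Iso 4 2 [cap 2] [cap 2] := .refl (by simp [Fits, Slice.pos, inputs, outputs])
  exact h1.append (((hT.flip.shift 1).widen 1).append h2)

/-- The diagonal through NW and SE exchanges the left and the upper side. Hence reflection
interchanges twists on the left with twists on top, here and in `iso_reflect_append_cross`. -/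
theorem iso_reflect_sum_cross {T : Tangle} (hT : Fits T 2 2) (s : Bool) :
    Iso 2 2 (Tangle.reflect (Tangle.sum [cross 0 s] T)) (Tangle.reflect T ++ [cross 0 s]) := by
  have hS := hT.flip
  have := iso_of_moves (n := 2) (m := 2)
    [.cup 0, .cup 2, .box (T.map Slice.flip).reverse 2 2 3, .cross 1 (!s), .cap 2, .cap 2]
    [.cup 0, .box (T.map Slice.flip).reverse 2 2 1, .cap 2, .cross 0 s]
    [(0, .up), (1, .up), (2, .slide), (3, .up), (2, .cancel)] [(2, .down)]
    (by simp [Valid, Piece.Ok, Piece.pos, Piece.ins, Piece.outs, hS])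
    (by simp [Valid, Piece.Ok, Piece.pos, Piece.ins, Piece.outs, hS]) rfl (by cases s <;> rfl)
  simpa only [assemble, Piece.word, Tangle.reflect, Tangle.rotate, Tangle.sum, List.map_cons,
    List.map_append, List.map_nil, List.reverse_cons, List.reverse_append, List.reverse_nil,
    List.nil_append, List.cons_append, List.append_assoc, List.append_nil, Slice.flip, shift,
    map_flip_map_shift, ← List.map_reverse, map_shift_shift] using this

theorem iso_reflect_append_cross {T : Tangle} (hT : Fits T 2 2) (s : Bool) :
    Iso 2 2 (Tangle.reflect (T ++ [cross 0 s])) (Tangle.sum [cross 0 s] (Tangle.reflect T)) := by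
  have hS := hT.flip
  have := iso_of_moves (n := 2) (m := 2)
    [.cup 0, .cross 1 (!s), .box (T.map Slice.flip).reverse 2 2 1, .cap 2]
    [.cup 1, .cross 0 s, .cup 2, .box (T.map Slice.flip).reverse 2 2 3, .cap 4, .cap 1]
    [(0, .slide)] [(4, .down), (3, .down), (2, .cancel)]
    (by simp [Valid, Piece.Ok, Piece.pos, Piece.ins, Piece.outs, hS])
    (by simp [Valid, Piece.Ok, Piece.pos, Piece.ins, Piece.outs, hS]) rfl (by cases s <;> rfl)
  simpa only [assemble, Piece.word, Tangle.reflect, Tangle.rotate, Tangle.sum, List.map_cons,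
    List.map_append, List.map_nil, List.reverse_cons, List.reverse_append, List.reverse_nil,
    List.nil_append, List.cons_append, List.append_assoc, List.append_nil, Slice.flip, shift,
    map_flip_map_shift, ← List.map_reverse, map_shift_shift] using this

theorem iso_reflect_inf : Iso 2 2 (Tangle.reflect []) [cap 0, cup 0 ()] := by
  have := iso_of_moves (n := 2) (m := 2) [.cup 0, .cap 2] [.cap 0, .cup 0] [(0, .up)] []
    (by simp [Valid, Piece.Ok, Piece.pos, Piece.ins, Piece.outs])
    (by simp [Valid, Piece.Ok, Piece.pos, Piece.ins, Piece.outs]) rfl rfl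
  simpa [assemble, Piece.word, Tangle.reflect, Tangle.rotate] using this

theorem iso_reflect_zero : Iso 2 2 (Tangle.reflect [cap 0, cup 0 ()]) [] := by
  have := iso_of_moves (n := 2) (m := 2) [.cup 0, .cap 1, .cup 1, .cap 2] []
    [(0, .cancel), (0, .cancel)] []
    (by simp [Valid, Piece.Ok, Piece.pos, Piece.ins, Piece.outs])
    (by simp [Valid]) rfl rfl
  simpa [assemble, Piece.word, Tangle.reflect, Tangle.rotate, Slice.flip, shift] using this

theorem iso_sum_assoc {T U V : Tangle} (hT : Fits T 2 2) (hU : Fits U 2 2) (hV : Fits V 2 2) :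
    Iso 2 2 (Tangle.sum T (Tangle.sum U V)) (Tangle.sum (Tangle.sum T U) V) := by
  have := iso_of_moves (n := 2) (m := 2)
    [.cup 1, .box T 2 2 0, .cup 3, .box U 2 2 2, .box V 2 2 4, .cap 3, .cap 1]
    [.cup 1, .cup 1, .box T 2 2 0, .box U 2 2 2, .cap 1, .box V 2 2 2, .cap 1]
    [(5, .down), (4, .down)] [(0, .down), (1, .down)]
    (by simp [Valid, Piece.Ok, Piece.pos, Piece.ins, Piece.outs, hT, hU, hV])
    (by simp [Valid, Piece.Ok, Piece.pos, Piece.ins, Piece.outs, hT, hU, hV]) rfl rfl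
  simpa [assemble, Piece.word, Tangle.sum, shift, -List.map_map] using this

theorem iso_sum_zero {T : Tangle} (hT : Fits T 2 2) :
    Iso 2 2 (Tangle.sum T [cap 0, cup 0 ()]) T := by
  have := iso_of_moves (n := 2) (m := 2)
    [.cup 1, .box T 2 2 0, .cap 2, .cup 2, .cap 1] [.box T 2 2 0]
    [(1, .up), (0, .cancel), (1, .cancel)] []
    (by simp [Valid, Piece.Ok, Piece.pos, Piece.ins, Piece.outs, hT])
    (by simp [Valid, Piece.Ok, Piece.pos, Piece.ins, Piece.outs, hT]) rfl rfl
  simpa [assemble, Piece.word, Tangle.sum, shift] using this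

/-! ### A strand that encircles a tangle -/

/-- The leftmost strand passes over (or under) the next `n` strands. -/
def passing (s : Bool) (n : ℕ) : Tangle := (List.range n).map (cross · s)

theorem passing_add (s : Bool) (a b : ℕ) :
    passing s (a + b) = passing s a ++ (passing s b).map (shift a) := by
  simp [passing, List.range_add, Function.comp_def, shift, Nat.add_comm]

theorem fits_passing (s : Bool) (n : ℕ) : Fits (passing s n) (n + 1) (n + 1) := by
  induction n with
  | zero => simp [passing, Fits]
  | succ n ih =>
    rw [passing_add]
    refine fits_append.2 ⟨n + 2, ih.widen 1, ?_⟩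
    simp [passing, Fits, shift, Slice.pos, inputs, outputs]

/-- A strand that is over (or under) everything slides across any slice: for a cup or cap by a slide
and a second Reidemeister move, for a crossing by a third one, whose condition holds because the two
crossings on the sliding strand have equal sign. -/
theorem iso_passing_core (g : Slice Unit) (s : Bool) (hg : g.pos = 0) :
    Iso (g.inputs + 1) (g.outputs + 1) (g.shift 1 :: passing s g.outputs)
      (passing s g.inputs ++ [g]) := by
  cases g with
  | cup i u =>
    obtain rfl : i = 0 := hg
    have := iso_of_moves (n := 1) (m := 3) [.cup 1, .cross 0 s, .cross 1 s] [.cup 0]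
      [(0, .slide), (1, .cancel)] []
      (by simp [Valid, Piece.Ok, Piece.pos, Piece.ins, Piece.outs])
      (by simp [Valid, Piece.Ok, Piece.pos, Piece.ins, Piece.outs])
      (by cases s <;> rfl) (by cases s <;> rfl)
    simpa [assemble, Piece.word, passing, List.range_succ, shift, inputs, outputs] using this
  | cap i =>
    obtain rfl : i = 0 := hg
    have := iso_of_moves (n := 3) (m := 1) [.cap 1] [.cross 0 s, .cross 1 s, .cap 0]
      [] [(1, .slide), (0, .cancel)]
      (by simp [Valid, Piece.Ok, Piece.pos, Piece.ins, Piece.outs])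
      (by simp [Valid, Piece.Ok, Piece.pos, Piece.ins, Piece.outs])
      (by cases s <;> rfl) (by cases s <;> rfl)
    simpa [assemble, Piece.word, passing, List.range_succ, shift, inputs, outputs] using this
  | cross i t =>
    obtain rfl : i = 0 := hg
    have := iso_of_moves (n := 3) (m := 3) [.cross 1 t, .cross 0 s, .cross 1 s]
      [.cross 0 s, .cross 1 s, .cross 0 t] [(0, .triangle)] []
      (by simp [Valid, Piece.Ok, Piece.pos, Piece.ins, Piece.outs])
      (by simp [Valid, Piece.Ok, Piece.pos, Piece.ins, Piece.outs])
      (by cases s <;> cases t <;> rfl) (by cases s <;> cases t <;> rfl)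
    simpa [assemble, Piece.word, passing, List.range_succ, shift, inputs, outputs] using this

theorem exists_core (g : Slice Unit) : ∃ c : Slice Unit, c.pos = 0 ∧ g = c.shift g.pos := by
  cases g with
  | cup i u => exact ⟨cup 0 u, rfl, by simp [shift, Slice.pos]⟩
  | cap i => exact ⟨cap 0, rfl, by simp [shift, Slice.pos]⟩
  | cross i s => exact ⟨cross 0 s, rfl, by simp [shift, Slice.pos]⟩

theorem iso_passing_slice (g : Slice Unit) (s : Bool) (j : ℕ) :
    Iso (g.pos + g.inputs + j + 1) (g.pos + g.outputs + j + 1)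
      (g.shift 1 :: passing s (g.pos + g.outputs + j)) (passing s (g.pos + g.inputs + j) ++ [g]) := by
  obtain ⟨c, hc, hg⟩ := exists_core g
  generalize g.pos = i at hg
  subst hg
  simp only [inputs_shift, outputs_shift, passing_add]
  have hcf : Fits [c] c.inputs c.outputs := by simp [Fits, hc]
  -- The sliding strand is cut into three stretches: over the strands to the left of the slice, over
  -- the slice itself, and over the strands to its right. Only the middle one is not an exchange of
  -- heights.
  have h1 : Iso (i + c.inputs + j + 1) (i + c.outputs + j + 1) (c.shift (i + 1) :: passing s i)
      (passing s i ++ [c.shift (i + 1)]) := by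
    have := (iso_exchange (k := 0) (j := 0) (fits_passing s i) hcf le_rfl j).symm
    simp only [Nat.zero_add, map_shift_zero, List.map_cons, List.map_nil, List.cons_append,
      List.nil_append] at this
    convert this using 1 <;> omega
  have h2 : Iso (i + c.inputs + j + 1) (i + c.outputs + j + 1)
      (c.shift (i + 1) :: (passing s c.outputs).map (shift i))
      ((passing s c.inputs).map (shift i) ++ [c.shift i]) := by
    have := ((iso_passing_core c s hc).shift i).widen j
    simp only [List.map_cons, List.map_append, List.map_nil, shift_shift] at this
    convert this using 1 <;> first | omega | simp only [Nat.add_comm 1 i]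
  have h3 : Iso (i + c.inputs + j + 1) (i + c.outputs + j + 1)
      (c.shift i :: (passing s j).map (shift (i + c.outputs)))
      ((passing s j).map (shift (i + c.inputs)) ++ [c.shift i]) := by
    have := iso_exchange (k := i) (j := i) hcf (fits_passing s j) le_rfl 0
    exact this
  have f1 : ∀ n : ℕ, Fits ((passing s n).map (shift i)) (i + n + j + 1) (i + n + j + 1) := by
    intro n
    convert ((fits_passing s n).shift i).widen j using 1 <;> omega
  have f2 : Fits ((passing s j).map (shift (i + c.outputs))) (i + c.outputs + j + 1)
      (i + c.outputs + j + 1) := by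
    convert (fits_passing s j).shift (i + c.outputs) using 1 <;> omega
  have f3 : Fits (passing s i) (i + c.inputs + j + 1) (i + c.inputs + j + 1) := by
    convert (fits_passing s i).widen (c.inputs + j) using 1 <;> omega
  have hA := h1.append ((Iso.refl (f1 c.outputs)).append (Iso.refl f2))
  have hB := (Iso.refl f3).append (h2.append (Iso.refl f2))
  have hC := (Iso.refl f3).append ((Iso.refl (f1 c.inputs)).append h3)
  simp only [shift_shift, List.append_assoc, List.cons_append, List.nil_append] at hA hB hC ⊢
  exact hA.trans (hB.trans hC)

theorem iso_passing {T : Tangle} {n m : ℕ} (hT : Fits T n m) (s : Bool) :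
    Iso (n + 1) (m + 1) (T.map (shift 1) ++ passing s m) (passing s n ++ T) := by
  induction T generalizing n with
  | nil =>
    simp only [Fits] at hT
    subst hT
    simpa using Iso.refl (fits_passing s n)
  | cons g T ih =>
    obtain ⟨h1, h2⟩ := hT
    obtain ⟨j, rfl⟩ := Nat.exists_eq_add_of_le h1
    have e : g.pos + g.inputs + j - g.inputs + g.outputs = g.pos + g.outputs + j := by omega
    rw [e] at h2
    have h3 : Iso (g.pos + g.inputs + j + 1) (g.pos + g.outputs + j + 1) [g.shift 1] [g.shift 1] := by
      refine .refl ?_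
      simp only [Fits, pos_shift, inputs_shift, outputs_shift]
      omega
    have h4 := h3.append (ih h2)
    have h5 := (iso_passing_slice g s j).append (Iso.refl (h2.widen 1))
    simpa using h4.trans (by simpa using h5)

/-- The strand from SW runs up to the left of `A`, across the top, down on the right and below the
tangle into its end SW, always over or always under the other three ends. Pushing it off `A` by
`iso_passing` leaves a curl and zigzags, which cancel. -/
theorem iso_encircle {A : Tangle} (hA : Fits A 2 2) (s : Bool) :
    Iso 2 2 ([cup 1 (), cross 2 s] ++ A.map (shift 1) ++ [cross 0 s, cross 1 s, cap 2]) A := by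
  have h1 := iso_of_moves (n := 2) (m := 2)
    [.cup 1, .cross 2 s, .cross 0 s, .cross 1 s, .box A 2 2 0, .cap 2] [.box A 2 2 0]
    [(1, .down), (0, .slide), (4, .up), (3, .slide), (2, .cancel), (1, .curl), (0, .cancel)] []
    (by simp [Valid, Piece.Ok, Piece.pos, Piece.ins, Piece.outs, hA])
    (by simp [Valid, Piece.Ok, Piece.pos, Piece.ins, Piece.outs, hA])
    (by cases s <;> rfl) (by cases s <;> rfl)
  have h2 : Iso 2 4 [cup 1 (), cross 2 s] [cup 1 (), cross 2 s] :=
    .refl (by simp [Fits, Slice.pos, inputs, outputs])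
  have h3 : Iso 4 2 [cap 2] [cap 2] := .refl (by simp [Fits, Slice.pos, inputs, outputs])
  have h4 := h2.append (((iso_passing hA s).widen 1).append h3)
  refine Iso.trans ?_ (by simpa [assemble, Piece.word] using h1)
  simpa [passing, List.range_succ] using h4

/-! ### Twists around the ends of a tangle -/

section Braids

variable {X : Type*} {a b c : Equiv.Perm X}

/-- The permutations `a`, `b`, `c` satisfy the relations of the braid group on four strands. -/
structure BraidRelations (a b c : Equiv.Perm X) : Prop where
  left : a * b * a = b * a * b
  right : b * c * b = c * b * c
  far : a * c = c * a

theorem BraidRelations.inv (h : BraidRelations a b c) : BraidRelations a⁻¹ b⁻¹ c⁻¹ where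
  left := by simpa [mul_assoc] using congrArg (·⁻¹) h.left
  right := by simpa [mul_assoc] using congrArg (·⁻¹) h.right
  far := by simpa using (congrArg (·⁻¹) h.far).symm

/-- The point `x` is fixed by the two generators `c⁻¹ a` and `b⁻¹ c⁻¹ a b` of the kernel of the
homomorphism from the braid group on four strands to that on three strands. -/
def FlypeFixed (a b c : Equiv.Perm X) (x : X) : Prop := a x = c x ∧ a (b x) = c (b x)

theorem inv_eq_inv_of_commute (h : a * c = c * a) {x : X} (hx : a x = c x) : a⁻¹ x = c⁻¹ x := by
  apply (a * c).injective
  calc (a * c) (a⁻¹ x) = (c * a) (a⁻¹ x) := by rw [h]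
    _ = c x := by simp
    _ = a x := hx.symm
    _ = (a * c) (c⁻¹ x) := by simp

/-- Trades a single `b⁻¹` next to `a` for a word in which the hypotheses on `x` and `a x` can be
applied from the right. -/
theorem mul_inv_eq_of_braid {a b : Equiv.Perm X} (h : a * b * a = b * a * b) :
    a * b⁻¹ = b⁻¹ * a⁻¹ * b * a := by
  apply mul_left_cancel (a := a * b)
  calc a * b * (a * b⁻¹) = a * b * a * b⁻¹ := by simp [mul_assoc]
    _ = b * a * b * b⁻¹ := by rw [h]
    _ = a * b * (b⁻¹ * a⁻¹ * b * a) := by simp [mul_assoc]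

namespace FlypeFixed

theorem apply_left (h : BraidRelations a b c) {x : X} (hx : FlypeFixed a b c x) :
    FlypeFixed a b c (a x) := by
  obtain ⟨h1, h2⟩ := hx
  constructor
  · calc a (a x) = (a * c) x := by simp [h1]
      _ = (c * a) x := by rw [h.far]
  · calc a (b (a x)) = (a * b * a) x := rfl
      _ = b (a (b x)) := by rw [h.left]; rfl
      _ = (b * c * b) x := by rw [h2]; rfl
      _ = c (b (c x)) := by rw [h.right]; rfl
      _ = c (b (a x)) := by rw [h1]

/-- Since `a` and `c` commute, it suffices that they agree at `b⁻¹ x`. Rewriting `a b⁻¹` as `b⁻¹ a⁻¹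
b a` reduces this to the second condition at `a x`, which holds by `apply_left`. -/
theorem inv (h : BraidRelations a b c) {x : X} (hx : FlypeFixed a b c x) :
    FlypeFixed a⁻¹ b⁻¹ c⁻¹ x := by
  refine ⟨inv_eq_inv_of_commute h.far hx.1, inv_eq_inv_of_commute h.far ?_⟩
  have h1 := hx.apply_left h
  calc a (b⁻¹ x) = (a * b⁻¹) x := rfl
    _ = b⁻¹ (a⁻¹ (b (a x))) := by rw [mul_inv_eq_of_braid h.left]; rfl
    _ = b⁻¹ (c⁻¹ (b (c x))) := by rw [inv_eq_inv_of_commute h.far h1.2, hx.1]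
    _ = (c * b⁻¹) x := by rw [mul_inv_eq_of_braid h.right.symm]; rfl

theorem of_inv (h : BraidRelations a b c) {x : X} (hx : FlypeFixed a⁻¹ b⁻¹ c⁻¹ x) :
    FlypeFixed a b c x := by
  simpa using hx.inv h.inv

theorem inv_apply_left (h : BraidRelations a b c) {x : X} (hx : FlypeFixed a b c x) :
    FlypeFixed a b c (a⁻¹ x) :=
  ((hx.inv h).apply_left h.inv).of_inv h

/-- For the inverse generators, the second condition at `b x` speaks about `b⁻¹ (b x) = x`. So the
two conditions at `x` are, in reversed order, those at `b x` for the inverses. -/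
theorem apply_middle (h : BraidRelations a b c) {x : X} (hx : FlypeFixed a b c x) :
    FlypeFixed a b c (b x) := by
  refine of_inv h ⟨inv_eq_inv_of_commute h.far hx.2, ?_⟩
  simpa using inv_eq_inv_of_commute h.far hx.1

theorem inv_apply_middle (h : BraidRelations a b c) {x : X} (hx : FlypeFixed a b c x) :
    FlypeFixed a b c (b⁻¹ x) :=
  of_inv h ((hx.inv h).apply_middle h.inv)

end FlypeFixed

/-! ### Rational tangles as an orbit -/

variable {r t : Equiv.Perm X} {z i : X}

/-- `r` and `t` act like the maps `x ↦ x + 1` and `x ↦ x / (x + 1)` on the slopes of rational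
tangles, with `z` of slope `0` and `i` of slope `∞`. -/
structure SlopeRelations (r t : Equiv.Perm X) (z i : X) : Prop where
  braid : r * t⁻¹ * r = t⁻¹ * r * t⁻¹
  fix_inf : r i = i
  fix_zero : t z = z
  one : r z = t i
  neg_one : r⁻¹ z = t⁻¹ i

theorem SlopeRelations.inv (h : SlopeRelations r t z i) : SlopeRelations r⁻¹ t⁻¹ z i where
  braid := by
    simpa [mul_assoc] using congrArg (·⁻¹) h.braid
  fix_inf := Equiv.Perm.inv_eq_iff_eq.2 h.fix_inf.symm
  fix_zero := Equiv.Perm.inv_eq_iff_eq.2 h.fix_zero.symm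
  one := h.neg_one
  neg_one := by simpa using h.one

theorem SlopeRelations.swap (h : SlopeRelations r t z i) : SlopeRelations t r i z where
  braid := by
    have h2 : r⁻¹ * t * r⁻¹ = t * r⁻¹ * t := by
      simpa [mul_assoc] using congrArg (·⁻¹) h.braid
    exact h2.symm
  fix_inf := h.fix_zero
  fix_zero := h.fix_inf
  one := h.one.symm
  neg_one := h.neg_one.symm

/-- The points of nonnegative slope (including `0` and `∞`). -/
inductive NonnegSlope (r t : Equiv.Perm X) (z i : X) : X → Prop
  | zero : NonnegSlope r t z i z
  | inf : NonnegSlope r t z i i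
  | right {x : X} (h : NonnegSlope r t z i x) : NonnegSlope r t z i (r x)
  | top {x : X} (h : NonnegSlope r t z i x) : NonnegSlope r t z i (t x)

namespace NonnegSlope

theorem swap {x : X} (h : NonnegSlope r t z i x) : NonnegSlope t r i z x := by
  induction h with
  | zero => exact .inf
  | inf => exact .zero
  | right _ ih => exact .top ih
  | top _ ih => exact .right ih

/-- The inversion `x ↦ -1 / x` takes nonpositive to nonnegative slopes. -/
theorem inversion (h : SlopeRelations r t z i) {x : X} (hx : NonnegSlope r⁻¹ t⁻¹ z i x) :
    NonnegSlope r t z i (r (t⁻¹ (r x))) := by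
  induction hx with
  | zero =>
    have : t⁻¹ (t i) = i := by simp
    rw [h.one, this, h.fix_inf]
    exact .inf
  | inf =>
    have : r (r⁻¹ z) = z := by simp
    rw [h.fix_inf, ← h.neg_one, this]
    exact .zero
  | @right y _ ih =>
    -- By the braid relation the inversion `r t⁻¹ r` conjugates `r⁻¹` into `t`, and in the other
    -- case `t⁻¹` into `r`.
    have : r (t⁻¹ (r (r⁻¹ y))) = t (r (t⁻¹ (r y))) := by
      calc r (t⁻¹ (r (r⁻¹ y))) = t ((t⁻¹ * r * t⁻¹) y) := by simp
        _ = t (r (t⁻¹ (r y))) := by rw [← h.braid]; rfl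
    rw [this]
    exact .top ih
  | @top y _ ih =>
    have : r (t⁻¹ (r (t⁻¹ y))) = r (r (t⁻¹ (r y))) := by
      calc r (t⁻¹ (r (t⁻¹ y))) = r ((t⁻¹ * r * t⁻¹) y) := rfl
        _ = r (r (t⁻¹ (r y))) := by rw [← h.braid]; rfl
    rw [this]
    exact .right ih

/-- On slopes, `x / (1 - x) + 1 = -1 / (x - 1)`: the map `r t⁻¹` is the inversion applied after
`r⁻¹`, and `r⁻¹` keeps slopes nonpositive. -/
theorem right_inv_top (h : SlopeRelations r t z i) {x : X} (hx : NonnegSlope r⁻¹ t⁻¹ z i x) :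
    NonnegSlope r t z i (r (t⁻¹ x)) := by
  simpa using inversion h hx.right

/-- If the last letter of a nonpositive word is `r⁻¹`, one factor `r` removes it; if it is `t⁻¹`, a
single `r` already makes the slope nonnegative. -/
theorem exists_pow (h : SlopeRelations r t z i) {x : X} (hx : NonnegSlope r⁻¹ t⁻¹ z i x) :
    ∃ k : ℕ, NonnegSlope r t z i ((r ^ k) x) := by
  induction hx with
  | zero => exact ⟨0, .zero⟩
  | inf => exact ⟨0, .inf⟩
  | @right y _ ih =>
    obtain ⟨k, hk⟩ := ih
    refine ⟨k + 1, ?_⟩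
    rw [pow_succ]
    simpa using hk
  | @top y hy _ =>
    exact ⟨1, by simpa using right_inv_top h hy⟩

theorem right_of_nonpos (h : SlopeRelations r t z i) {x : X} (hx : NonnegSlope r⁻¹ t⁻¹ z i x) :
    NonnegSlope r t z i (r x) ∨ NonnegSlope r⁻¹ t⁻¹ z i (r x) := by
  cases hx with
  | zero => exact .inl (.right .zero)
  | inf =>
    rw [h.fix_inf]
    exact .inl .inf
  | @right y hy =>
    right
    simpa using hy
  | @top y hy => exact .inl (right_inv_top h hy)

end NonnegSlope

/-- The slope is nonnegative or nonpositive. -/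
def HasSlope (r t : Equiv.Perm X) (z i x : X) : Prop :=
  NonnegSlope r t z i x ∨ NonnegSlope r⁻¹ t⁻¹ z i x

theorem HasSlope.right (h : SlopeRelations r t z i) {x : X} (hx : HasSlope r t z i x) :
    HasSlope r t z i (r x) := by
  rcases hx with hx | hx
  · exact .inl hx.right
  · exact NonnegSlope.right_of_nonpos h hx

theorem HasSlope.inv {x : X} (hx : HasSlope r t z i x) : HasSlope r⁻¹ t⁻¹ z i x := by
  rw [HasSlope, inv_inv, inv_inv]
  exact hx.symm

theorem HasSlope.swap {x : X} (hx : HasSlope r t z i x) : HasSlope t r i z x :=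
  hx.imp .swap .swap

theorem HasSlope.inv_right (h : SlopeRelations r t z i) {x : X} (hx : HasSlope r t z i x) :
    HasSlope r t z i (r⁻¹ x) := by
  simpa using (hx.inv.right h.inv).inv

theorem HasSlope.exists_pow (h : SlopeRelations r t z i) {x : X} (hx : HasSlope r t z i x) :
    ∃ k : ℕ, NonnegSlope r t z i ((r ^ k) x) := by
  rcases hx with hx | hx
  · exact ⟨0, by simpa using hx⟩
  · exact hx.exists_pow h

/-- The orbit of `z` and `i`. -/
inductive InOrbit (a b : Equiv.Perm X) (z i : X) : X → Prop
  | zero : InOrbit a b z i z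
  | inf : InOrbit a b z i i
  | left {x : X} (h : InOrbit a b z i x) : InOrbit a b z i (a x)
  | inv_left {x : X} (h : InOrbit a b z i x) : InOrbit a b z i (a⁻¹ x)
  | middle {x : X} (h : InOrbit a b z i x) : InOrbit a b z i (b x)
  | inv_middle {x : X} (h : InOrbit a b z i x) : InOrbit a b z i (b⁻¹ x)

namespace InOrbit

theorem flypeFixed (h : BraidRelations a b c) (hz : FlypeFixed a b c z) (hi : FlypeFixed a b c i)
    {x : X} (hx : InOrbit a b z i x) : FlypeFixed a b c x := by
  induction hx with
  | zero => exact hz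
  | inf => exact hi
  | left _ ih => exact ih.apply_left h
  | inv_left _ ih => exact ih.inv_apply_left h
  | middle _ ih => exact ih.apply_middle h
  | inv_middle _ ih => exact ih.inv_apply_middle h

/-- On the orbit `a` acts as `c`, that is, as the inverse of `r = c⁻¹`, so the generators act
through `r` and `t = b` alone, and these preserve the union of the nonnegative and nonpositive
slopes. -/
theorem hasSlope (h : BraidRelations a b c) (hz : FlypeFixed a b c z) (hi : FlypeFixed a b c i)
    (hs : SlopeRelations c⁻¹ b z i) {x : X} (hx : InOrbit a b z i x) :
    HasSlope c⁻¹ b z i x := by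
  induction hx with
  | zero => exact .inl .zero
  | inf => exact .inl .inf
  | left hx ih =>
    rw [(hx.flypeFixed h hz hi).1]
    simpa using ih.inv_right hs
  | inv_left hx ih =>
    rw [((hx.flypeFixed h hz hi).inv h).1]
    exact ih.right hs
  | middle _ ih => exact (ih.swap.right hs.swap).swap
  | inv_middle _ ih => exact (ih.swap.inv_right hs.swap).swap

end InOrbit

end Braids

/-! ### Rational tangles up to isotopy -/

/-- Isotopy of words with four upper ends. -/
def hatSetoid : Setoid {W : Tangle // Fits W 0 4} where
  r W W' := Iso 0 4 W W'
  iseqv := ⟨fun W => .refl W.2, .symm, .trans⟩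

/-- The words with four upper ends up to isotopy. -/
abbrev Hat : Type := Quotient hatSetoid

/-- The isotopy class of a word with four upper ends. -/
def Hat.mk (W : Tangle) (hW : Fits W 0 4) : Hat := Quotient.mk hatSetoid ⟨W, hW⟩

theorem Hat.mk_eq {W W' : Tangle} {hW : Fits W 0 4} {hW' : Fits W' 0 4} :
    Hat.mk W hW = Hat.mk W' hW' ↔ Iso 0 4 W W' := Quotient.eq

theorem Hat.exists_mk (x : Hat) : ∃ W hW, Hat.mk W hW = x := by
  induction x using Quotient.inductionOn with
  | h W => exact ⟨W.1, W.2, rfl⟩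

theorem fits_cross {i n : ℕ} (h : i + 2 ≤ n) (s : Bool) : Fits [cross i s] n n := by
  simp only [Fits, Slice.pos, inputs, outputs]
  omega

theorem Fits.append_cross {W : Tangle} (hW : Fits W 0 4) (i : Fin 3) (s : Bool) :
    Fits (W ++ [cross i s]) 0 4 :=
  fits_append.2 ⟨4, hW, fits_cross (by omega) s⟩

theorem Iso.append_left {W V V' : Tangle} {n k m : ℕ} (hW : Fits W n k) (h : Iso k m V V') :
    Iso n m (W ++ V) (W ++ V') := (Iso.refl hW).append h

theorem Iso.append_right {W W' V : Tangle} {n k m : ℕ} (h : Iso n k W W') (hV : Fits V k m) :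
    Iso n m (W ++ V) (W' ++ V) := h.append (Iso.refl hV)

theorem iso_cross_cancel {i n : ℕ} (h : i + 2 ≤ n) (s : Bool) :
    Iso n n [cross i s, cross i (!s)] [] :=
  .move (.reidemeister2 i s) ((fits_append (u := [cross i s])).2 ⟨n, fits_cross h s, fits_cross h _⟩)
    rfl

/-- Add a crossing to two neighbouring upper ends. -/
def addCross (i : Fin 3) (s : Bool) : Hat → Hat :=
  Quotient.map (fun W => ⟨W.1 ++ [cross i s], W.2.append_cross i s⟩)
    fun _ _ h => Iso.append_right h (fits_cross (by omega) s)

theorem addCross_mk (i : Fin 3) (s : Bool) {W : Tangle} (hW : Fits W 0 4) :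
    addCross i s (Hat.mk W hW) = Hat.mk (W ++ [cross i s]) (hW.append_cross i s) := rfl

theorem addCross_addCross (i : Fin 3) (s : Bool) (x : Hat) :
    addCross i (!s) (addCross i s x) = x := by
  obtain ⟨W, hW, rfl⟩ := x.exists_mk
  rw [addCross_mk, addCross_mk, Hat.mk_eq]
  simpa using Iso.append_left hW (iso_cross_cancel (i := i) (by omega) s)

/-- Adding a crossing as a permutation. -/
def twist (i : Fin 3) (s : Bool) : Equiv.Perm Hat where
  toFun := addCross i s
  invFun := addCross i (!s)
  left_inv := addCross_addCross i s
  right_inv x := by simpa using addCross_addCross i (!s) x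

theorem twist_inv (i : Fin 3) (s : Bool) : (twist i s)⁻¹ = twist i (!s) := Equiv.ext fun _ => rfl

theorem twist_mk (i : Fin 3) (s : Bool) {W : Tangle} (hW : Fits W 0 4) :
    twist i s (Hat.mk W hW) = Hat.mk (W ++ [cross i s]) (hW.append_cross i s) := rfl

theorem braidRelations_twist :
    BraidRelations (twist 0 true) (twist 1 true) (twist 2 true) := by
  have braid : ∀ i < 2, Iso 4 4 [cross i true, cross (i + 1) true, cross i true]
      [cross (i + 1) true, cross i true, cross (i + 1) true] := by
    intro i hi
    refine .move (.reidemeister3 i true true true (.inl rfl)) ?_ ?_ <;>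
      simp only [Fits, Slice.pos, inputs, outputs, and_true] <;> omega
  refine ⟨Equiv.ext fun x => ?_, Equiv.ext fun x => ?_, Equiv.ext fun x => ?_⟩ <;>
    obtain ⟨W, hW, rfl⟩ := x.exists_mk <;>
    simp only [Equiv.Perm.mul_apply, twist_mk, Hat.mk_eq, List.append_assoc, List.cons_append,
      List.nil_append] <;>
    refine Iso.append_left hW ?_
  · exact braid 0 (by omega)
  · exact braid 1 (by omega)
  · refine (Iso.move (.exchange (cross 0 true) (cross 0 true) le_rfl) ?_ ?_).symm <;>
      simp [Fits, Slice.pos, inputs, outputs, Slice.shift]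

/-- The tangle of slope `0`. -/
def hatZero : Hat := Hat.mk [cup 0 (), cup 1 ()] (by simp [Fits, Slice.pos, inputs, outputs])

/-- The tangle of slope `∞`. -/
def hatInf : Hat := Hat.mk [cup 0 (), cup 2 ()] (by simp [Fits, Slice.pos, inputs, outputs])

theorem twist_zero_inf (s : Bool) : twist 0 s hatInf = hatInf :=
  Hat.mk_eq.2 (iso_inf_cross_zero s)

theorem twist_two_inf (s : Bool) : twist 2 s hatInf = hatInf :=
  Hat.mk_eq.2 (iso_inf_cross_two s)

theorem twist_one_zero (s : Bool) : twist 1 s hatZero = hatZero :=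
  Hat.mk_eq.2 (iso_zero_cross_one s)

theorem twist_zero_zero (s : Bool) : twist 0 s hatZero = twist 1 (!s) hatInf :=
  Hat.mk_eq.2 (iso_zero_cross_zero s)

theorem twist_two_zero (s : Bool) : twist 2 s hatZero = twist 1 (!s) hatInf :=
  Hat.mk_eq.2 (iso_zero_cross_two s)

theorem flypeFixed_zero : FlypeFixed (twist 0 true) (twist 1 true) (twist 2 true) hatZero := by
  refine ⟨?_, ?_⟩ <;> simp [twist_one_zero, twist_zero_zero, twist_two_zero]

theorem flypeFixed_inf : FlypeFixed (twist 0 true) (twist 1 true) (twist 2 true) hatInf := by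
  refine ⟨by simp [twist_zero_inf, twist_two_inf], ?_⟩
  have h0 : twist 1 true hatInf = (twist 0 true)⁻¹ hatZero := by
    rw [twist_inv, twist_zero_zero]; rfl
  have h2 : twist 1 true hatInf = (twist 2 true)⁻¹ hatZero := by
    rw [twist_inv, twist_two_zero]; rfl
  calc twist 0 true (twist 1 true hatInf) = hatZero := by rw [h0]; simp
    _ = twist 2 true (twist 1 true hatInf) := by rw [h2]; simp

/-- The inverse appears because the crossing `cross 2 true` at the upper ends is a negative twist on
the right of the tangle; its inverse adds `1` to the slope. -/
theorem slopeRelations_twist :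
    SlopeRelations (twist 2 true)⁻¹ (twist 1 true) hatZero hatInf where
  braid := braidRelations_twist.inv.right.symm
  fix_inf := by rw [twist_inv, twist_two_inf]
  fix_zero := twist_one_zero _
  one := by rw [twist_inv, twist_two_zero]; rfl
  neg_one := by rw [inv_inv, twist_inv, twist_two_zero]

/-- The classes of rational tangles. -/
abbrev HatRational : Hat → Prop := InOrbit (twist 0 true) (twist 1 true) hatZero hatInf

theorem HatRational.twist_eq {x : Hat} (hx : HatRational x) (s : Bool) :
    twist 0 s x = twist 2 s x := by
  have h := hx.flypeFixed braidRelations_twist flypeFixed_zero flypeFixed_inf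
  cases s
  · exact (h.inv braidRelations_twist).1
  · exact h.1

/-- The orbit is generated by twists on the left and on top only; twists on the right come for free
from the flype. -/
theorem HatRational.twist {x : Hat} (hx : HatRational x) (i : Fin 3) (s : Bool) :
    HatRational (twist i s x) := by
  have h0 : ∀ s, HatRational (Knots.twist 0 s x) := by
    intro s
    cases s
    exacts [hx.inv_left, hx.left]
  fin_cases i
  · exact h0 s
  · cases s
    exacts [hx.inv_middle, hx.middle]
  · have := hx.twist_eq s
    exact this ▸ h0 s

/-! ### Operations that keep tangles rational -/

/-- The tangle is isotopic to a rational one. -/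
def Rationalish (T : Tangle) : Prop :=
  ∃ W hW, HatRational (Hat.mk W hW) ∧ Iso 2 2 T (unhat W)

namespace Rationalish

theorem fits {T : Tangle} (h : Rationalish T) : Fits T 2 2 := by
  obtain ⟨W, hW, -, h⟩ := h
  exact h.fits.1

theorem of_iso {T T' : Tangle} (h : Rationalish T) (hT : Iso 2 2 T' T) : Rationalish T' := by
  obtain ⟨W, hW, hx, h⟩ := h
  exact ⟨W, hW, hx, hT.trans h⟩

theorem zero : Rationalish [cap 0, cup 0 ()] :=
  ⟨_, _, InOrbit.zero, iso_unhat_zero.symm⟩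

theorem inf : Rationalish [] := ⟨_, _, InOrbit.inf, iso_unhat_inf.symm⟩

theorem append_cross {T : Tangle} (h : Rationalish T) (s : Bool) :
    Rationalish (T ++ [cross 0 s]) := by
  obtain ⟨W, hW, hx, h⟩ := h
  exact ⟨_, _, hx.twist 1 s, (h.append_right (fits_cross (by omega) s)).trans
    (iso_unhat_append_cross hW s)⟩

theorem sum_cross {T : Tangle} (h : Rationalish T) (s : Bool) :
    Rationalish (Tangle.sum T [cross 0 s]) := by
  obtain ⟨W, hW, hx, h⟩ := h
  exact ⟨_, _, hx.twist 2 (!s), (h.sum (.refl (fits_cross (by omega) s))).trans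
    (iso_sum_unhat_cross hW s)⟩

theorem cross_sum {T : Tangle} (h : Rationalish T) (s : Bool) :
    Rationalish (Tangle.sum [cross 0 s] T) := by
  obtain ⟨W, hW, hx, h⟩ := h
  exact ⟨_, _, hx.twist 0 (!s), (Iso.sum (.refl (fits_cross (by omega) s)) h).trans
    (iso_sum_cross_unhat hW s)⟩

/-- The flype for a single crossing, read off from the equality of the left and right twists on the
orbit. -/
theorem iso_flype {T : Tangle} (h : Rationalish T) (s : Bool) :
    Iso 2 2 (Tangle.sum [cross 0 s] T) (Tangle.sum T [cross 0 s]) := by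
  obtain ⟨W, hW, hx, h⟩ := h
  have hs : Iso 2 2 [cross 0 s] [cross 0 s] := .refl (fits_cross (by omega) s)
  have h1 := hx.twist_eq (!s)
  rw [twist_mk, twist_mk, Hat.mk_eq] at h1
  exact (hs.sum h).trans ((iso_sum_cross_unhat hW s).trans
    (h1.unhat.trans ((iso_sum_unhat_cross hW s).symm.trans (h.symm.sum hs))))

/-- Induction over the orbit. Its generators are twists on the left and on top, which reflection
interchanges, and `0` and `∞` are interchanged too. Some representative `W` suffices, since
reflection respects isotopy. -/
theorem reflect_unhat {x : Hat} (hx : HatRational x) :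
    ∃ W hW, Hat.mk W hW = x ∧ Rationalish (Tangle.reflect (unhat W)) := by
  have left : ∀ {x : Hat} (s : Bool),
      (∃ W hW, Hat.mk W hW = x ∧ Rationalish (Tangle.reflect (unhat W))) →
        ∃ W hW, Hat.mk W hW = Knots.twist 0 s x ∧ Rationalish (Tangle.reflect (unhat W)) := by
    rintro x s ⟨W, hW, rfl, h⟩
    refine ⟨_, _, (twist_mk 0 s hW).symm, (h.append_cross (!s)).of_iso ?_⟩
    have h1 := (iso_sum_cross_unhat hW (!s)).symm.reflect
    rw [Bool.not_not] at h1
    exact h1.trans (iso_reflect_sum_cross hW.unhat (!s))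
  have middle : ∀ {x : Hat} (s : Bool),
      (∃ W hW, Hat.mk W hW = x ∧ Rationalish (Tangle.reflect (unhat W))) →
        ∃ W hW, Hat.mk W hW = Knots.twist 1 s x ∧ Rationalish (Tangle.reflect (unhat W)) := by
    rintro x s ⟨W, hW, rfl, h⟩
    refine ⟨_, _, (twist_mk 1 s hW).symm, (h.cross_sum s).of_iso ?_⟩
    exact (iso_unhat_append_cross hW s).symm.reflect.trans (iso_reflect_append_cross hW.unhat s)
  induction hx with
  | zero =>
    exact ⟨_, _, rfl, inf.of_iso (iso_unhat_zero.reflect.trans iso_reflect_zero)⟩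
  | inf =>
    exact ⟨_, _, rfl, zero.of_iso (iso_unhat_inf.reflect.trans iso_reflect_inf)⟩
  | left _ ih => exact left true ih
  | inv_left _ ih => exact left false ih
  | middle _ ih => exact middle true ih
  | inv_middle _ ih => exact middle false ih

theorem reflect {T : Tangle} (h : Rationalish T) : Rationalish (Tangle.reflect T) := by
  obtain ⟨W, hW, hx, h⟩ := h
  obtain ⟨W', hW', hWW', h'⟩ := reflect_unhat hx
  exact h'.of_iso (h.trans (Hat.mk_eq.1 hWW').unhat.symm).reflect

end Rationalish

theorem fits_twists (s : Bool) (n : ℕ) : Fits (Tangle.twists s n) 2 2 := by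
  induction n with
  | zero => simp [Tangle.twists, Fits, Slice.pos, inputs, outputs]
  | succ n ih => exact ih.sum (fits_cross (by omega) s)

theorem iso_sum_twists_succ {T : Tangle} (hT : Fits T 2 2) (s : Bool) (n : ℕ) :
    Iso 2 2 (Tangle.sum T (Tangle.twists s (n + 1)))
      (Tangle.sum (Tangle.sum T (Tangle.twists s n)) [cross 0 s]) :=
  iso_sum_assoc hT (fits_twists s n) (fits_cross (by omega) s)

namespace Rationalish

theorem sum_twists {T : Tangle} (h : Rationalish T) (s : Bool) (n : ℕ) :
    Rationalish (Tangle.sum T (Tangle.twists s n)) := by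
  induction n with
  | zero => exact h.of_iso (iso_sum_zero h.fits)
  | succ n ih => exact (ih.sum_cross s).of_iso (iso_sum_twists_succ h.fits s n)

theorem twists (s : Bool) (n : ℕ) : Rationalish (Tangle.twists s n) := by
  induction n with
  | zero => exact zero
  | succ n ih => exact ih.sum_cross s

theorem integral (a : ℤ) : Rationalish (Tangle.integral a) := by
  cases a <;> exact twists _ _

theorem sum_integral {T : Tangle} (h : Rationalish T) (a : ℤ) :
    Rationalish (Tangle.sum T (Tangle.integral a)) := by
  cases a <;> exact h.sum_twists _ _

end Rationalish

theorem Tangle.IsRational.rationalish {T : Tangle} (h : Tangle.IsRational T) : Rationalish T := by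
  induction h with
  | integral a => exact .integral a
  | product T a _ ih => exact ih.reflect.sum_integral a

/-! ### Normal forms -/

/-- The two generators of nonnegative slopes add a negative crossing at the even position `2` or a
positive one at the odd position `1`; both have the type `false`. -/
theorem exists_checkered {x : Hat}
    (h : NonnegSlope (twist 2 true)⁻¹ (twist 1 true) hatZero hatInf x) :
    ∃ W hW, Hat.mk W hW = x ∧ Checkered false W := by
  have append : ∀ {W : Tangle} {i : ℕ} {s : Bool}, Checkered false W → s = xor false i.bodd →
      Checkered false (W ++ [cross i s]) :=
    fun hW hs => hW.append (checkered_cross.2 hs)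
  induction h with
  | zero => exact ⟨_, _, rfl, by simp [Checkered]⟩
  | inf => exact ⟨_, _, rfl, by simp [Checkered]⟩
  | right _ ih =>
    obtain ⟨W, hW, rfl, h⟩ := ih
    exact ⟨W ++ [cross 2 false], hW.append_cross 2 false, rfl, append h rfl⟩
  | top _ ih =>
    obtain ⟨W, hW, rfl, h⟩ := ih
    exact ⟨W ++ [cross 1 true], hW.append_cross 1 true, rfl, append h rfl⟩

theorem Checkered.unhat {W : Tangle} (h : Checkered false W) : Checkered true (unhat W) :=
  (h.shift 1).append (by simp [Checkered])

/-- Each positive crossing at position `2` becomes one negative half twist on the right of the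
tangle. -/
theorem iso_unhat_of_mk_eq_pow {V W : Tangle} {hV : Fits V 0 4} {hW : Fits W 0 4} {k : ℕ}
    (h : Hat.mk W hW = (twist 2 true ^ k) (Hat.mk V hV)) :
    Iso 2 2 (unhat W) (Tangle.sum (unhat V) (Tangle.twists false k)) := by
  induction k generalizing W with
  | zero =>
    rw [pow_zero, Equiv.Perm.one_apply, Hat.mk_eq] at h
    exact h.unhat.trans (iso_sum_zero hV.unhat).symm
  | succ k ih =>
    obtain ⟨U, hU, hUk⟩ := ((twist 2 true ^ k) (Hat.mk V hV)).exists_mk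
    rw [pow_succ', Equiv.Perm.mul_apply, ← hUk, twist_mk, Hat.mk_eq] at h
    have h1 := (iso_sum_unhat_cross hU false).symm
    have h2 := (ih hUk).sum (.refl (fits_cross (i := 0) (n := 2) (by omega) false))
    exact h.unhat.trans (h1.trans (h2.trans (iso_sum_twists_succ hV.unhat false k).symm))

/-- A rational tangle is the sum of one of nonnegative slope and a row of negative crossings. -/
theorem Rationalish.exists_normalForm {T : Tangle} (h : Rationalish T) :
    ∃ A k, Rationalish A ∧ Checkered true A ∧
      Iso 2 2 T (Tangle.sum A (Tangle.twists false k)) := by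
  obtain ⟨W, hW, hx, hT⟩ := h
  obtain ⟨k, hk⟩ := (hx.hasSlope braidRelations_twist flypeFixed_zero flypeFixed_inf
    slopeRelations_twist).exists_pow slopeRelations_twist
  obtain ⟨V, hV, hVk, hc⟩ := exists_checkered hk
  -- The untwisted tangle stays in the orbit; its rationality is needed later to flype rows of
  -- twists past it.
  have hpow : ∀ j : ℕ, HatRational ((((twist 2 true)⁻¹) ^ j) (Hat.mk W hW)) := by
    intro j
    induction j with
    | zero => simpa using hx
    | succ j ih =>
      rw [pow_succ', Equiv.Perm.mul_apply, twist_inv]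
      rw [twist_inv] at ih
      exact ih.twist 2 _
  refine ⟨unhat V, k, ⟨V, hV, hVk ▸ hpow k, .refl hV.unhat⟩, hc.unhat, hT.trans ?_⟩
  refine iso_unhat_of_mk_eq_pow (hV := hV) (hW := hW) ?_
  rw [hVk, ← Equiv.Perm.mul_apply, inv_pow, mul_inv_cancel, Equiv.Perm.one_apply]

/-! ### Sums of rational tangles -/

theorem iso_zero_sum {T : Tangle} (hT : Fits T 2 2) :
    Iso 2 2 (Tangle.sum [cap 0, cup 0 ()] T) T := by
  have := iso_of_moves (n := 2) (m := 2)
    [.cup 1, .cap 0, .cup 0, .box T 2 2 2, .cap 1] [.box T 2 2 0]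
    [(0, .cancel), (0, .up), (1, .cancel)] []
    (by simp [Valid, Piece.Ok, Piece.pos, Piece.ins, Piece.outs, hT])
    (by simp [Valid, Piece.Ok, Piece.pos, Piece.ins, Piece.outs, hT]) rfl rfl
  simpa [assemble, Piece.word, Tangle.sum] using this

theorem iso_twists_sum_twists (s : Bool) (k j : ℕ) :
    Iso 2 2 (Tangle.sum (Tangle.twists s k) (Tangle.twists s j)) (Tangle.twists s (k + j)) := by
  induction j with
  | zero => exact iso_sum_zero (fits_twists s k)
  | succ j ih =>
    exact (iso_sum_twists_succ (fits_twists s k) s j).trans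
      (ih.sum (.refl (fits_cross (by omega) s)))

theorem Rationalish.iso_twists_sum {T : Tangle} (h : Rationalish T) (s : Bool) (k : ℕ) :
    Iso 2 2 (Tangle.sum (Tangle.twists s k) T) (Tangle.sum T (Tangle.twists s k)) := by
  induction k with
  | zero => exact (iso_zero_sum h.fits).trans (iso_sum_zero h.fits).symm
  | succ k ih =>
    have hk := fits_twists s k
    have hc : Fits [cross 0 s] 2 2 := fits_cross (by omega) s
    have h1 := (iso_sum_assoc hk hc h.fits).symm
    have h2 := (Iso.refl hk).sum (h.iso_flype s)
    have h3 := iso_sum_assoc hk h.fits hc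
    have h4 := ih.sum (.refl hc)
    exact h1.trans (h2.trans (h3.trans (h4.trans (iso_sum_twists_succ h.fits s k).symm)))

/-- The row behind `A` is flyped through `B` and merges with the row behind `B`; only `B` has to be
rational. -/
theorem iso_sum_sum_twists {A B : Tangle} (hA : Fits A 2 2) (hB : Rationalish B) (s : Bool)
    (k j : ℕ) :
    Iso 2 2 (Tangle.sum (Tangle.sum A (Tangle.twists s k)) (Tangle.sum B (Tangle.twists s j)))
      (Tangle.sum (Tangle.sum A B) (Tangle.twists s (k + j))) := by
  have hk := fits_twists s k
  have hj := fits_twists s j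
  have h1 := (iso_sum_assoc hA hk (hB.fits.sum hj)).symm
  have h2 := (iso_sum_assoc hk hB.fits hj).trans ((hB.iso_twists_sum s k).sum (.refl hj))
  have h3 := (iso_sum_assoc hB.fits hk hj).symm.trans
    ((Iso.refl hB.fits).sum (iso_twists_sum_twists s k j))
  exact h1.trans (((Iso.refl hA).sum (h2.trans h3)).trans
    (iso_sum_assoc hA hB.fits (fits_twists s _)))

/-- The second summand is shifted by two strands, which keeps the parity of positions and hence the
type. -/
theorem Checkered.sum {c : Bool} {A B : Tangle} (hA : Checkered c A) (hB : Checkered c B) :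
    Checkered c (Tangle.sum A B) := by
  have h := hB.shift 2
  simp only [Nat.bodd_succ, Nat.bodd_zero, Bool.not_false, Bool.not_true, Bool.xor_false] at h
  exact checkered_cons.2 ⟨checkered_cup, (hA.append h).append checkered_cap⟩

theorem checkered_twists_false (k : ℕ) : Checkered false (Tangle.twists false k) := by
  induction k with
  | zero => simp [Tangle.twists, Checkered]
  | succ k ih => exact ih.sum (checkered_cross.2 rfl)

/-- A sum of rational tangles is isotopic to the sum of an alternating tangle with positive
crossings and a row of negative crossings. -/
theorem exists_normalForm_sum {T : Tangle} (Ts : List Tangle)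
    (hT : ∃ A k, Fits A 2 2 ∧ Checkered true A ∧ Iso 2 2 T (Tangle.sum A (Tangle.twists false k)))
    (hTs : ∀ S ∈ Ts, Rationalish S) :
    ∃ A k, Fits A 2 2 ∧ Checkered true A ∧
      Iso 2 2 (Ts.foldl Tangle.sum T) (Tangle.sum A (Tangle.twists false k)) := by
  induction Ts generalizing T with
  | nil => exact hT
  | cons S Ts ih =>
    refine ih ?_ fun S' hS' => hTs S' (List.mem_cons_of_mem _ hS')
    obtain ⟨A, k, hA, hAc, h⟩ := hT
    obtain ⟨B, j, hB, hBc, h'⟩ := (hTs S List.mem_cons_self).exists_normalForm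
    exact ⟨Tangle.sum A B, k + j, hA.sum hB.fits, hAc.sum hBc,
      (h.sum h').trans (iso_sum_sum_twists hA hB false k j)⟩

/-! ### Almost alternating diagrams of Montesinos links -/

theorem Iso.numerator {T T' : Tangle} (h : Iso 2 2 T T') :
    Iso 0 0 (Tangle.numerator T) (Tangle.numerator T') := by
  have h1 : Iso 0 2 [cup 0 ()] [cup 0 ()] := .refl (by simp [Fits, Slice.pos, inputs, outputs])
  have h2 : Iso 2 0 [cap 0] [cap 0] := .refl (by simp [Fits, Slice.pos, inputs, outputs])
  exact h1.append (h.append h2)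

theorem CrossingChanges.rfl {α : Type} (w : List (Slice α)) : CrossingChanges 0 w w := by
  induction w with
  | nil => exact .nil
  | cons g w ih => exact .keep g ih

theorem CrossingChanges.eq_of_zero {α : Type} {w w' : List (Slice α)}
    (h : CrossingChanges 0 w w') : w' = w := by
  generalize hn : 0 = n at h
  induction h with
  | nil => exact Eq.refl _
  | keep g h ih => rw [ih hn]
  | change i s h ih => omega

theorem CrossingChanges.single {α : Type} (u v : List (Slice α)) (i : ℕ) (s : Bool) :
    CrossingChanges 1 (u ++ cross i s :: v) (u ++ cross i (!s) :: v) := by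
  induction u with
  | nil => exact .change i s (.rfl v)
  | cons g u ih => exact .keep g ih

/-- `A` and `B` have opposite types. Running a strand around `A` shifts it by one position, and its
type becomes that of `B`, at the cost of one crossing of the wrong type. -/
theorem exists_almostAlternating_diagram {A B : Tangle} (hA : Fits A 2 2) (hB : Fits B 2 2)
    (hAc : Checkered true A) (hBc : Checkered false B) {L : Link} {D : LinkDiagram}
    (hD : L.HasDiagram D) {w : Tangle} (hw : D.word.map forget = w)
    (h : Iso 0 0 w (Tangle.numerator (Tangle.sum A B))) :
    ∃ D' : LinkDiagram, L.HasDiagram D' ∧ D'.IsNAlmostAlternating 1 := by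
  -- With the sign `false`, the new crossings at the even positions `2` and `0` have the type
  -- `false`; the one at position `1` is the only wrong crossing.
  have h1 := h.trans (((iso_encircle hA false).symm.sum (.refl hB)).numerator)
  obtain ⟨D', hD', hw'⟩ := h1.exists_diagram hD hw
  refine ⟨D', hD', ?_⟩
  obtain ⟨word, hrun⟩ := D'
  have e : word.map forget =
      (cup 0 () :: cup 1 () :: cup 1 () :: cross 2 false :: (A.map (shift 1) ++ [cross 0 false])) ++
        cross 1 false :: (cap 2 :: (B.map (shift 2) ++ [cap 1, cap 0])) := by
    simpa [Tangle.numerator, Tangle.sum] using hw'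
  obtain ⟨U, V', rfl, hU, hV'⟩ := List.map_eq_append_iff.1 e
  obtain ⟨x, V, rfl, hx, hV⟩ := List.map_eq_cons_iff.1 hV'
  obtain rfl := forget_eq_cross.1 hx
  -- The action of a crossing on orientations ignores its sign, so the changed word is still a
  -- closed oriented diagram.
  have hrun' : run (U ++ cross 1 true :: V) [] = some [] := by
    rw [← hrun, run_append, run_append]
    rfl
  refine ⟨⟨U ++ cross 1 true :: V, hrun'⟩, CrossingChanges.single U V 1 false, ?_⟩
  have hc : Checkered false (U ++ cross 1 true :: V) := by
    rw [← checkered_forget, List.map_append, List.map_cons, hU, hV]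
    have hA' : Checkered false (A.map (shift 1)) := hAc.shift 1
    have hB' : Checkered false (B.map (shift 2)) := hBc.shift 2
    refine checkered_append.2 ⟨?_, ?_⟩
    · refine Checkered.append (u := [cup 0 (), cup 1 (), cup 1 (), cross 2 false]) ?_
        (hA'.append (checkered_cross.2 rfl))
      simp [Checkered]
    · refine Checkered.append (u := [cross 1 true, cap 2]) ?_ (hB'.append ?_) <;> simp [Checkered]
  exact hc.alternating

theorem Link.IsMontesinos.exists_almostAlternating_diagram {L : Link} (hL : L.IsMontesinos) :
    ∃ D : LinkDiagram, L.HasDiagram D ∧ D.IsNAlmostAlternating 1 := by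
  obtain ⟨D, R, Rs, hD, hR, hw⟩ := hL
  obtain ⟨A₀, k₀, hA₀, hc₀, h₀⟩ := (hR R List.mem_cons_self).rationalish.exists_normalForm
  obtain ⟨A, k, hA, hc, h⟩ := exists_normalForm_sum Rs ⟨A₀, k₀, hA₀.fits, hc₀, h₀⟩
    fun S hS => (hR S (List.mem_cons_of_mem _ hS)).rationalish
  exact Knots.exists_almostAlternating_diagram hA (fits_twists false k) hc
    (checkered_twists_false k) hD hw h.numerator

theorem Link.isAlternating_iff {L : Link} :
    L.IsAlternating ↔ ∃ D, L.HasDiagram D ∧ D.IsNAlmostAlternating 0 := by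
  constructor
  · rintro ⟨D, hD, h⟩
    exact ⟨D, hD, D, .rfl _, h⟩
  · rintro ⟨D, hD, E, hE, h⟩
    obtain ⟨w, hw⟩ := D
    obtain ⟨w', hw'⟩ := E
    obtain rfl : w' = w := hE.eq_of_zero
    exact ⟨_, hD, h⟩

end Knots

theorem proposition6p5 (L : Knots.Link) (hL : L.IsMontesinos) :
    (L.IsAlternating ∨ L.IsAlmostAlternating) ∧
      ∃ n : ℕ, n ≤ 1 ∧ L.HasDealternatingNumber n := by
  by_cases h : L.IsAlternating
  · exact ⟨.inl h, 0, zero_le_one, Knots.Link.isAlternating_iff.1 h, fun k hk => by omega⟩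
  · have h1 : L.IsNAlmostAlternating 1 := by
      refine ⟨hL.exists_almostAlternating_diagram, fun k hk => ?_⟩
      obtain rfl : k = 0 := by omega
      exact fun h0 => h (Knots.Link.isAlternating_iff.2 h0)
    exact ⟨.inr h1, 1, le_rfl, h1⟩
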